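/- Let $X$ be a Banach space over $\mathbb{T}\in\{\mathbb{R},\mathbb{C}\}$ and let $X^*$ be its dual with the dual norm. A $C_0$-semigroup on $X$ is a family $(T(s))_{s\ge 0}$ of bounded linear operators with $T(0)=I$ and $T(l+m)=T(l)T(m)$ for $l,m\ge 0$, such that $s\mapsto T(s)x$ is norm continuous on $[0,\infty)$ for every $x\in X$, and $\|T(s)\|\le Ke^{bs}$ for $s\ge 0$ with some constants $K>1$, $b\in\mathbb{R}$. For a map $S$ from $[0,\infty)$ to the bounded operators on a normed space, $S'(0)$ denotes the linear operator $S'(0)\psi=\lim_{h\to 0+}h^{-1}(S(h)\psi-S(0)\psi)$ (norm limit), whose domain $\mathcal{D}(S'(0))$ is the set of all $\psi$ for which the limit exists; the generator of a $C_0$-semigroup $T$ is $T'(0)$. Write $S^*$ for the map $s\mapsto S(s)^*$ (Banach space adjoint), and $[\,\cdot\,]$ for the integer part. Let $t>0$ and let $C$ and $D$ be the generators of $C_0$-semigroups $e^{sC}$ and $e^{sD}$ on $X$. Let $(e^{sC})^{*\prime}(0)$ and $(e^{sD})^{*\prime}(0)$ be the derivatives at $0$, in the above sense on $X^*$, of $s\mapsto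 (e^{sC})^*$ and $s\mapsto (e^{sD})^*$. Let $B\subseteq\mathcal{D}\big((e^{sC})^{*\prime}(0)\big)\cap\mathcal{D}\big((e^{sD})^{*\prime}(0)\big)$ be a set, and assume: (i) $\mathcal{D}(C)\cap\mathcal{D}(D)$ is dense in $X$; (ii) $B$ is weak-$*$ dense in $X^*$; (iii) there are $a\in\mathbb{R}$ and $M\ge 1$ such that $\big\|\big(e^{\frac{s}{n}C}e^{\frac{s}{n}D}\big)^m\big\|\le M e^{as\frac{m}{n}}$ for all integers $n,m\ge 1$ and all $s>0$; (iv) for every $x$ in the image of $B$ under $(e^{sC})^{*\prime}(0)$, the function $s\mapsto (e^{sD})^*x$, $s\ge 0$, is norm continuous at $s=0$. Let $C+D$ have the domain $\mathcal{D}(C)\cap\mathcal{D}(D)$. Then $C+D$ is closable and its closure is the generator of a $C_0$-semigroup if and only if the following holds: (*) there is a dense linear subspace $A\subseteq\mathcal{D}(C)\cap\mathcal{D}(D)$ such that for all $f\in A$ and $s\ge 0$ there is a sequence $(f_n)_{n\ge 1}$ in $\mathcal{D}(C)\cap\mathcal{D}(D)$ with (a) $\lim_{n\to\infty}\big\|\big(e^{\frac{t}{n}C}e^{\frac{t}{n}D}\big)^{[ns]}f-f_n\big\|=0$;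 (b) every subsequence of $(f_n)$ has a further subsequence that converges weakly in $X$; (c) every subsequence of $((C+D)f_n)$ has a further subsequence that converges weakly in $X$. Furthermore, if (*) holds, then, $e^{s\overline{C+D}}$ denoting the $C_0$-semigroup generated by $\overline{C+D}$, $$e^{s\overline{C+D}}f=\lim_{n\to\infty}\big(e^{\frac{s}{n}C}e^{\frac{s}{n}D}\big)^n f\quad\text{in norm, for all } s\ge 0 \text{ and } f\in X.$$ -/

import Mathlib

open Filter Topology
open scoped NNReal

noncomputable section

namespace TrotterChernoff

variable {𝕜 : Type*} [RCLike 𝕜] {E : Type*} [NormedAddCommGroup E] [NormedSpace 𝕜 E]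

/-- `y` is the limit of the difference quotients `h⁻¹ (S(h) ψ - S(0) ψ)` as `h → 0`, `h > 0`, in
the norm of `E`. -/
def HasDerivZero (S : ℝ≥0 → E →L[𝕜] E) (ψ y : E) : Prop :=
  Tendsto (fun h : ℝ≥0 => ((h : ℝ) : 𝕜)⁻¹ • (S h ψ - S 0 ψ)) (𝓝[>] 0) (𝓝 y)

theorem HasDerivZero.add {S : ℝ≥0 → E →L[𝕜] E} {ψ₁ ψ₂ y₁ y₂ : E}
    (h₁ : HasDerivZero S ψ₁ y₁) (h₂ : HasDerivZero S ψ₂ y₂) :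
    HasDerivZero S (ψ₁ + ψ₂) (y₁ + y₂) := by
  refine (Tendsto.add h₁ h₂).congr fun h => ?_
  rw [← smul_add, map_add, map_add]
  congr 1
  abel

theorem HasDerivZero.smul {S : ℝ≥0 → E →L[𝕜] E} {ψ y : E} (c : 𝕜)
    (h₁ : HasDerivZero S ψ y) : HasDerivZero S (c • ψ) (c • y) := by
  refine (Tendsto.const_smul h₁ c).congr fun h => ?_
  rw [map_smul, map_smul, ← smul_sub, smul_comm]

theorem HasDerivZero.zero (S : ℝ≥0 → E →L[𝕜] E) : HasDerivZero S 0 0 := by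
  simp [HasDerivZero]

theorem HasDerivZero.unique {S : ℝ≥0 → E →L[𝕜] E} {ψ y₁ y₂ : E}
    (h₁ : HasDerivZero S ψ y₁) (h₂ : HasDerivZero S ψ y₂) : y₁ = y₂ :=
  tendsto_nhds_unique h₁ h₂

/-- The strong derivative at `0` of an operator-valued function `S` on `[0, ∞)`, as a linear
operator whose domain consists of all `ψ` for which the limit of the difference quotients exists. -/
def derivZero (S : ℝ≥0 → E →L[𝕜] E) : E →ₗ.[𝕜] E where
  domain :=
    { carrier := {ψ | ∃ y, HasDerivZero S ψ y}
      add_mem' := fun ⟨_, h₁⟩ ⟨_, h₂⟩ => ⟨_, h₁.add h₂⟩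
      zero_mem' := ⟨0, HasDerivZero.zero S⟩
      smul_mem' := fun c _ ⟨_, h⟩ => ⟨_, h.smul c⟩ }
  toFun :=
    { toFun := fun ψ => Classical.choose ψ.2
      map_add' := fun ψ₁ ψ₂ => (Classical.choose_spec (ψ₁ + ψ₂).2).unique
        ((Classical.choose_spec ψ₁.2).add (Classical.choose_spec ψ₂.2))
      map_smul' := fun c ψ => (Classical.choose_spec (c • ψ).2).unique
        ((Classical.choose_spec ψ.2).smul c) }

theorem mem_derivZero_domain {S : ℝ≥0 → E →L[𝕜] E} {ψ : E} :
    ψ ∈ (derivZero S).domain ↔ ∃ y, HasDerivZero S ψ y :=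
  Iff.rfl

theorem hasDerivZero_derivZero (S : ℝ≥0 → E →L[𝕜] E) (ψ : (derivZero S).domain) :
    HasDerivZero S ψ (derivZero S ψ) :=
  Classical.choose_spec ψ.2

/-- `C₀`-semigroups of bounded operators, indexed by `[0, ∞)`. -/
structure IsC0Semigroup (T : ℝ≥0 → E →L[𝕜] E) : Prop where
  map_zero : T 0 = 1
  map_add : ∀ l m : ℝ≥0, T (l + m) = T l * T m
  /-- continuity for the strong operator topology -/
  continuous_apply : ∀ x : E, Continuous fun s : ℝ≥0 => T s x
  exists_bound : ∃ M a : ℝ, 1 < M ∧ ∀ s : ℝ≥0, ‖T s‖ ≤ M * Real.exp (a * s)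

/-- `Z` (with its domain) is the generator of the `C₀`-semigroup `T`. -/
def IsGeneratorOf (Z : E →ₗ.[𝕜] E) (T : ℝ≥0 → E →L[𝕜] E) : Prop :=
  IsC0Semigroup T ∧ Z = derivZero T

/-- The pointwise Banach space adjoint `s ↦ S(s)^*`, with `S(s)^* φ = φ ∘ S(s)`. -/
def adjointFun (S : ℝ≥0 → E →L[𝕜] E) (s : ℝ≥0) : StrongDual 𝕜 E →L[𝕜] StrongDual 𝕜 E :=
  ContinuousLinearMap.precomp 𝕜 (S s)

/-- Every subsequence of `u` has a further subsequence that converges weakly in `E`. -/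
def HasWeaklyConvergentSubsubsequences (𝕜 : Type*) [RCLike 𝕜] {E : Type*} [NormedAddCommGroup E]
    [NormedSpace 𝕜 E] (u : ℕ → E) : Prop :=
  ∀ i : ℕ → ℕ, StrictMono i → ∃ j : ℕ → ℕ, StrictMono j ∧ ∃ y : E,
    Tendsto (fun k => toWeakSpace 𝕜 E (u (i (j k)))) atTop (𝓝 (toWeakSpace 𝕜 E y))

/-- There is a dense subspace `A` of the domain of `Z` such that for all `f ∈ A` and `s ≥ 0` the
iterates `F(t/n)^[ns] f` are asymptotic to a sequence `g n` in the domain of `Z` for which `g` and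
`Z g` both have weakly convergent subsubsequences. -/
def HasApproximants (Z : E →ₗ.[𝕜] E) (F : ℝ≥0 → E →L[𝕜] E) (t : ℝ≥0) : Prop :=
  ∃ A : Submodule 𝕜 E, A ≤ Z.domain ∧ Dense (A : Set E) ∧
    ∀ f ∈ A, ∀ s : ℝ≥0, ∃ g : ℕ → Z.domain,
      Tendsto (fun n : ℕ => ‖((F (t / n)) ^ ⌊n * s⌋₊) f - g n‖) atTop (𝓝 0) ∧
      HasWeaklyConvergentSubsubsequences 𝕜 (fun n => (g n : E)) ∧
      HasWeaklyConvergentSubsubsequences 𝕜 (fun n => Z (g n))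

end TrotterChernoff

end

/-! Write `F h = e^{hC} e^{hD}` and let `G` be the graph of `C + D`. By (iii) the powers of `F` are
stable, and the product rule makes `F` consistent with `C + D`. By (iv) the product rule also
applies to the adjoints: every `φ ∈ B` has a derivative `ψ` at zero under `F(h)^*`. Hence `φ z = ψ
x` for all `(x, z)` in the closure of `G`, and since `B` separates points, this closure is the graph
of an operator.

From (*) to a generator: let `f ∈ A` and `z = (C + D) f`. By (a), (b), a diagonal argument and
equicontinuity in time, the orbits of `f` and `z` under powers of `F` converge weakly at all times
along one sequence of steps, to `y s` and `v s`. Consistency makes `v` the right derivative of `y`.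
By (c), and because closed subspaces are weakly closed, some `(y s, w)` lies in the closure of `G`.
As `F h` commutes with its powers, `φ (v s) = ψ (y s) = φ w` on `B`, so `w = v s` and `y` solves the
Cauchy problem for the closure (`exists_hasRightDeriv`). Stability and consistency then force norm
convergence to this solution (`tendsto_pow_floor_of_hasRightDeriv`), and the limits form a semigroup
generated by the closure (`exists_isC0Semigroup`).

Conversely, for a semigroup `T` generated by the closure, Chernoff's formula sends the orbits of `f`
to points `T (t * s) f` of the domain of the closure, and approximants are read off a sequence in
`G`. -/

open Filter Topology
open scoped NNReal

noncomputable section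

namespace TrotterChernoff

/-! ### Stability and consistency of the powers of `F h`. -/

section

variable {𝕜 : Type*} [RCLike 𝕜] {E : Type*} [NormedAddCommGroup E] [NormedSpace 𝕜 E]

/-- The powers `F(h)^m` are bounded uniformly as long as `m h` stays bounded. -/
def IsLocallyStable (F : ℝ≥0 → E →L[𝕜] E) : Prop :=
  ∀ S : ℝ, ∃ K : ℝ, 1 ≤ K ∧ ∀ h : ℝ≥0, 0 < h → ∀ m : ℕ, (m : ℝ) * h ≤ S → ‖F h ^ m‖ ≤ K

theorem isLocallyStable_of_exp {F : ℝ≥0 → E →L[𝕜] E} {M a : ℝ} (hM : 1 ≤ M)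
    (hF : ∀ h : ℝ≥0, 0 < h → ∀ m : ℕ, ‖F h ^ m‖ ≤ M * Real.exp (a * (m * h))) :
    IsLocallyStable F := by
  intro S
  refine ⟨M * Real.exp (|a| * |S|), ?_, fun h hh m hm => (hF h hh m).trans ?_⟩
  · have : (1 : ℝ) ≤ Real.exp (|a| * |S|) := Real.one_le_exp (by positivity)
    nlinarith
  · gcongr M * Real.exp ?_
    calc a * (m * h) ≤ |a| * (m * h) := by gcongr; exact le_abs_self a
      _ ≤ |a| * |S| := by gcongr; exact hm.trans (le_abs_self S)

theorem norm_pow_sub_le (P : E →L[𝕜] E) {K : ℝ} (m : ℕ) (hP : ∀ j < m, ‖P ^ j‖ ≤ K) (x : E) :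
    ‖(P ^ m) x - x‖ ≤ m * (K * ‖P x - x‖) := by
  induction m with
  | zero => simp
  | succ m ih =>
    have h1 : (P ^ (m + 1)) x - x = (P ^ m) (P x - x) + ((P ^ m) x - x) := by
      rw [pow_succ, map_sub]; simp
    rw [h1]
    have h2 := (P ^ m).le_of_opNorm_le (hP m (by simp)) (P x - x)
    have h3 := ih fun j hj => hP j (by omega)
    have := norm_add_le ((P ^ m) (P x - x)) ((P ^ m) x - x)
    rw [Nat.cast_succ]
    linarith

/-- Telescoping: the left side is the sum over `j < m` of `P ^ j (P x - x - w) + (P ^ j w - w)`. It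
is used with `w = h • z`, the expected increment of one step. -/
theorem norm_pow_sub_sub_le (P : E →L[𝕜] E) {K η : ℝ} (m : ℕ) (hP : ∀ j < m, ‖P ^ j‖ ≤ K)
    (x w : E) (hw : ∀ j < m, ‖(P ^ j) w - w‖ ≤ η) :
    ‖(P ^ m) x - x - m • w‖ ≤ m * (K * ‖P x - x - w‖ + η) := by
  induction m with
  | zero => simp
  | succ m ih =>
    have h1 : (P ^ (m + 1)) x - x - (m + 1) • w =
        (P ^ m) (P x - x - w) + ((P ^ m) w - w) + ((P ^ m) x - x - m • w) := by
      rw [pow_succ, map_sub, map_sub, succ_nsmul]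
      simp only [mul_apply_eq_comp]
      abel
    rw [h1]
    have h2 := (P ^ m).le_of_opNorm_le (hP m (by simp)) (P x - x - w)
    have h3 := ih (fun j hj => hP j (by omega)) fun j hj => hw j (by omega)
    have h4 := hw m (by simp)
    have := norm_add₃_le (a := (P ^ m) (P x - x - w)) (b := (P ^ m) w - w)
      (c := (P ^ m) x - x - m • w)
    rw [Nat.cast_succ]
    linarith

variable [NormedSpace ℝ E] [IsScalarTower ℝ 𝕜 E]

/-- A division-free form with real scalars, whose errors can be summed over many steps. -/
theorem hasDerivZero_iff {F : ℝ≥0 → E →L[𝕜] E} (h0 : F 0 = 1) {x z : E} :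
    HasDerivZero F x z ↔
      ∀ ε : ℝ, 0 < ε → ∀ᶠ h : ℝ≥0 in 𝓝[>] 0, ‖F h x - x - (h : ℝ) • z‖ ≤ ε * h := by
  unfold HasDerivZero
  rw [Metric.tendsto_nhds]
  have key : ∀ h : ℝ≥0, 0 < h → ‖F h x - x - (h : ℝ) • z‖ =
      h * dist (((h : ℝ) : 𝕜)⁻¹ • (F h x - F 0 x)) z := by
    intro h hh
    have hh' : (0 : ℝ) < h := hh
    have h1 : F h x - x - (h : ℝ) • z =
        (h : ℝ) • (((h : ℝ) : 𝕜)⁻¹ • (F h x - F 0 x) - z) := by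
      rw [smul_sub, RCLike.real_smul_eq_coe_smul (K := 𝕜) (h : ℝ) (_ • _), smul_smul,
        mul_inv_cancel₀ (by exact_mod_cast hh'.ne'), one_smul, h0]
      simp
    rw [h1, norm_smul, dist_eq_norm, Real.norm_of_nonneg hh'.le]
  constructor
  · intro H ε hε
    filter_upwards [H ε hε, self_mem_nhdsWithin] with h h1 (hh : 0 < h)
    rw [key h hh, mul_comm]
    gcongr
  · intro H ε hε
    filter_upwards [H (ε / 2) (by positivity), self_mem_nhdsWithin] with h h1 (hh : 0 < h)
    have hh' : (0 : ℝ) < h := hh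
    rw [key h hh, mul_comm] at h1
    have := le_of_mul_le_mul_right h1 hh'
    linarith

theorem eventually_coe_lt {δ : ℝ} (hδ : 0 < δ) : ∀ᶠ h : ℝ≥0 in 𝓝[>] 0, (h : ℝ) < δ := by
  have : ∀ᶠ h : ℝ≥0 in 𝓝 0, (h : ℝ) < δ :=
    (NNReal.continuous_coe.tendsto 0).eventually_lt_const (by simpa using hδ)
  exact this.filter_mono nhdsWithin_le_nhds

variable {F : ℝ≥0 → E →L[𝕜] E} {G : Set (E × E)}

/-- Equicontinuity at time zero. On first components of `G`, telescoping bounds the displacement by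
a multiple of `k * h`; stability and density extend this to all `x`. -/
theorem eventually_norm_pow_sub_le (h0 : F 0 = 1) (hF : IsLocallyStable F)
    (hG : ∀ p ∈ G, HasDerivZero F p.1 p.2) (hd : Dense (Prod.fst '' G)) (x : E) {ε : ℝ}
    (hε : 0 < ε) :
    ∃ δ : ℝ, 0 < δ ∧ ∀ᶠ h : ℝ≥0 in 𝓝[>] 0, ∀ k : ℕ, (k : ℝ) * h ≤ δ →
      ‖(F h ^ k) x - x‖ ≤ ε := by
  obtain ⟨K, hK1, hK⟩ := hF 1
  obtain ⟨x', ⟨p, hp, rfl⟩, hx'⟩ := hd.exists_dist_lt x (ε := ε / (2 * (K + 1))) (by positivity)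
  rw [dist_eq_norm] at hx'
  set δ : ℝ := min 1 (ε / (2 * K * (‖p.2‖ + 1))) with hδ
  have hδ0 : 0 < δ := by positivity
  refine ⟨δ, hδ0, ?_⟩
  filter_upwards [(hasDerivZero_iff h0).1 (hG p hp) 1 one_pos, self_mem_nhdsWithin]
    with h h1 (hh : 0 < h) k hk
  have hPk : ∀ j ≤ k, ‖F h ^ j‖ ≤ K := fun j hj => hK h hh j <| by
    refine le_trans ?_ (hk.trans (min_le_left _ _))
    gcongr
  have h2 := norm_pow_sub_le (F h) k (fun j hj => hPk j hj.le) p.1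
  have h3 : ‖F h p.1 - p.1‖ ≤ h * (‖p.2‖ + 1) := by
    have : F h p.1 - p.1 = (F h p.1 - p.1 - (h : ℝ) • p.2) + (h : ℝ) • p.2 := by abel
    rw [this]
    refine (norm_add_le _ _).trans ?_
    rw [norm_smul, Real.norm_of_nonneg h.coe_nonneg]
    linarith
  have h4 : ‖(F h ^ k) p.1 - p.1‖ ≤ ε / 2 := by
    calc _ ≤ k * (K * (h * (‖p.2‖ + 1))) := h2.trans (by gcongr)
      _ = (k * h) * (K * (‖p.2‖ + 1)) := by ring
      _ ≤ (ε / (2 * K * (‖p.2‖ + 1))) * (K * (‖p.2‖ + 1)) := by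
        gcongr
        exact hk.trans (min_le_right _ _)
      _ = ε / 2 := by
        field_simp
  have h5 : (F h ^ k) x - x = (F h ^ k) (x - p.1) + ((F h ^ k) p.1 - p.1) - (x - p.1) := by
    rw [map_sub]; abel
  have h6 := (F h ^ k).le_of_opNorm_le (hPk k le_rfl) (x - p.1)
  have h7 : (K + 1) * ‖x - p.1‖ ≤ ε / 2 := by
    calc _ ≤ (K + 1) * (ε / (2 * (K + 1))) := by gcongr
      _ = ε / 2 := by field_simp
  rw [h5]
  have h8 := norm_sub_le ((F h ^ k) (x - p.1) + ((F h ^ k) p.1 - p.1)) (x - p.1)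
  have h9 := norm_add_le ((F h ^ k) (x - p.1)) ((F h ^ k) p.1 - p.1)
  linarith

theorem eventually_norm_pow_sub_pow_le (h0 : F 0 = 1) (hF : IsLocallyStable F)
    (hG : ∀ p ∈ G, HasDerivZero F p.1 p.2) (hd : Dense (Prod.fst '' G)) (x : E) (S : ℝ) {ε : ℝ}
    (hε : 0 < ε) :
    ∃ δ : ℝ, 0 < δ ∧ ∀ᶠ h : ℝ≥0 in 𝓝[>] 0, ∀ j k : ℕ, (j : ℝ) * h ≤ S → (k : ℝ) * h ≤ S →
      |(j : ℝ) * h - k * h| ≤ δ → ‖(F h ^ j) x - (F h ^ k) x‖ ≤ ε := by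
  obtain ⟨K, hK1, hK⟩ := hF S
  obtain ⟨δ, hδ, H⟩ := eventually_norm_pow_sub_le h0 hF hG hd x (ε := ε / K) (by positivity)
  refine ⟨δ, hδ, ?_⟩
  filter_upwards [H, self_mem_nhdsWithin] with h h1 (hh : 0 < h)
  have key : ∀ j i : ℕ, (j : ℝ) * h ≤ S → (i : ℝ) * h ≤ δ →
      ‖(F h ^ (j + i)) x - (F h ^ j) x‖ ≤ ε := by
    intro j i hj hi
    rw [pow_add, mul_apply_eq_comp, ← map_sub]
    refine ((F h ^ j).le_of_opNorm_le (hK h hh j hj) _).trans ?_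
    calc K * ‖(F h ^ i) x - x‖ ≤ K * (ε / K) := by gcongr; exact h1 i hi
      _ = ε := by field_simp
  intro j k hj hk hjk
  rcases le_total j k with hle | hle
  · obtain ⟨i, rfl⟩ := Nat.exists_eq_add_of_le hle
    rw [norm_sub_rev]
    refine key j i hj ?_
    rw [abs_le] at hjk
    push_cast at hjk
    linarith
  · obtain ⟨i, rfl⟩ := Nat.exists_eq_add_of_le hle
    refine key k i hk ?_
    rw [abs_le] at hjk
    push_cast at hjk
    linarith

/-- First order consistency of `F(h)^m`, `m h ≈ δ`, on the closure of a graph on which the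
derivative of `F` at zero is known. -/
theorem eventually_norm_pow_sub_smul_le (h0 : F 0 = 1) (hF : IsLocallyStable F)
    (hG : ∀ p ∈ G, HasDerivZero F p.1 p.2) (hd : Dense (Prod.fst '' G)) {x z : E}
    (hxz : (x, z) ∈ closure G) {ε : ℝ} (hε : 0 < ε) :
    ∃ δ₀ : ℝ, 0 < δ₀ ∧ ∀ δ : ℝ, 0 < δ → δ ≤ δ₀ → ∀ᶠ h : ℝ≥0 in 𝓝[>] 0, ∀ m : ℕ,
      |(m : ℝ) * h - δ| ≤ h → ‖(F h ^ m) x - x - δ • z‖ ≤ ε * δ := by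
  obtain ⟨K, hK1, hK⟩ := hF 2
  -- The error terms below add up to at most `(5 * (K + 1) + 3) * η * δ`, which the factor 10
  -- covers.
  set η : ℝ := ε / (10 * (K + 1)) with hη
  have hη0 : 0 < η := by positivity
  obtain ⟨δ₁, hδ₁, H⟩ := eventually_norm_pow_sub_le h0 hF hG hd z hη0
  refine ⟨min 1 (δ₁ / 2), by positivity, fun δ hδ hδ' => ?_⟩
  -- Replacing `x` by `p.1` must cost only `O(η * δ)`, so `p` depends on `δ`; this is why the range
  -- of admissible `h` depends on `δ` too.
  obtain ⟨p, hp, hp'⟩ := Metric.mem_closure_iff.1 hxz (min η (η * δ)) (by positivity)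
  rw [Prod.dist_eq, max_lt_iff, dist_eq_norm, dist_eq_norm] at hp'
  obtain ⟨hp1, hp2⟩ := hp'
  replace hp1 := (hp1.trans_le (min_le_right _ _)).le
  replace hp2 := (hp2.trans_le (min_le_left _ _)).le
  simp only at hp1 hp2
  filter_upwards [H, self_mem_nhdsWithin, eventually_coe_lt hδ,
    eventually_coe_lt (δ := η * δ / (‖z‖ + 1)) (by positivity),
    (hasDerivZero_iff h0).1 (hG p hp) η hη0] with h h1 (hh : 0 < h) h2 h3 h4 m hm
  have hh' : (0 : ℝ) < h := hh
  have hmh : (m : ℝ) * h ≤ 2 * δ := by linarith [(abs_le.1 hm).2]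
  have hδ1 := hδ'.trans (min_le_left _ _)
  have hδ2 := hδ'.trans (min_le_right _ _)
  have hj : ∀ j ≤ m, (j : ℝ) * h ≤ 2 * δ := fun j hj => le_trans (by gcongr) hmh
  have hPk : ∀ j ≤ m, ‖F h ^ j‖ ≤ K := fun j hjm => hK h hh j (by linarith [hj j hjm])
  have e1 : ∀ j < m, ‖(F h ^ j) ((h : ℝ) • p.2) - (h : ℝ) • p.2‖ ≤ h * ((K + 2) * η) := by
    intro j hjm
    have : (F h ^ j) ((h : ℝ) • p.2) - (h : ℝ) • p.2 =
        (h : ℝ) • (((F h ^ j) z - z) - (F h ^ j) (z - p.2) + (z - p.2)) := by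
      rw [RCLike.real_smul_eq_coe_smul (K := 𝕜), RCLike.real_smul_eq_coe_smul (K := 𝕜), map_smul,
        ← smul_sub, map_sub]
      congr 1
      abel
    rw [this, norm_smul, Real.norm_of_nonneg hh'.le]
    gcongr
    have a1 := h1 j (by linarith [hj j hjm.le])
    have a2 : ‖(F h ^ j) (z - p.2)‖ ≤ K * η :=
      ((F h ^ j).le_of_opNorm_le (hPk j hjm.le) _).trans (by gcongr)
    have a3 := norm_add_le (((F h ^ j) z - z) - (F h ^ j) (z - p.2)) (z - p.2)
    have a4 := norm_sub_le ((F h ^ j) z - z) ((F h ^ j) (z - p.2))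
    linarith
  have e2 := norm_pow_sub_sub_le (F h) m (fun j hjm => hPk j hjm.le) p.1 ((h : ℝ) • p.2) e1
  have e3 : ‖(F h ^ m) p.1 - p.1 - m • ((h : ℝ) • p.2)‖ ≤ 4 * (K + 1) * η * δ := by
    refine e2.trans ?_
    calc m * (K * ‖F h p.1 - p.1 - (h : ℝ) • p.2‖ + h * ((K + 2) * η))
        ≤ m * (K * (η * h) + h * ((K + 2) * η)) := by gcongr
      _ = (m * h) * (2 * (K + 1) * η) := by ring
      _ ≤ (2 * δ) * (2 * (K + 1) * η) := by gcongr
      _ = _ := by ring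
  have e4 : (F h ^ m) x - x - δ • z = ((F h ^ m) p.1 - p.1 - m • ((h : ℝ) • p.2)) +
      ((F h ^ m) (x - p.1) - (x - p.1)) + ((((m : ℝ) * h - δ) • z) - ((m : ℝ) * h) • (z - p.2)) := by
    rw [← Nat.cast_smul_eq_nsmul ℝ m, smul_smul, sub_smul, smul_sub, map_sub]
    abel
  have e5 : ‖(F h ^ m) (x - p.1)‖ ≤ K * (η * δ) :=
    ((F h ^ m).le_of_opNorm_le (hPk m le_rfl) _).trans (by gcongr)
  have e6 : ‖((m : ℝ) * h - δ) • z‖ ≤ η * δ := by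
    rw [norm_smul, Real.norm_eq_abs]
    calc |(m : ℝ) * h - δ| * ‖z‖ ≤ (η * δ / (‖z‖ + 1)) * (‖z‖ + 1) := by
          gcongr
          · exact hm.trans h3.le
          · linarith
      _ = η * δ := by field_simp
  have e7 : ‖((m : ℝ) * h) • (z - p.2)‖ ≤ 2 * δ * η := by
    rw [norm_smul, Real.norm_of_nonneg (by positivity)]
    gcongr
  have e8 : 10 * (K + 1) * η = ε := by rw [hη]; field_simp
  rw [e4]
  refine (norm_add₃_le).trans ?_
  have f1 := norm_sub_le ((F h ^ m) (x - p.1)) (x - p.1)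
  have f2 := norm_sub_le (((m : ℝ) * h - δ) • z) (((m : ℝ) * h) • (z - p.2))
  rw [← e8]
  have : 0 ≤ η * δ := by positivity
  have : 0 ≤ K * (η * δ) := by positivity
  nlinarith

end

/-! ### Convergence of the powers to solutions of the Cauchy problem. -/

section

variable {𝕜 : Type*} [RCLike 𝕜] {E : Type*} [NormedAddCommGroup E] [NormedSpace 𝕜 E]
variable [NormedSpace ℝ E] [IsScalarTower ℝ 𝕜 E]
variable {F : ℝ≥0 → E →L[𝕜] E} {G : Set (E × E)}

/-- The right derivative of `y` at `s` is `z`. -/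
def HasRightDeriv (y : ℝ≥0 → E) (s : ℝ≥0) (z : E) : Prop :=
  ∀ ε : ℝ, 0 < ε → ∀ᶠ δ : ℝ≥0 in 𝓝[>] 0, ‖y (s + δ) - y s - (δ : ℝ) • z‖ ≤ ε * δ

theorem floor_div_mul_le (s : ℝ≥0) {h : ℝ≥0} (hh : 0 < h) : (⌊s / h⌋₊ : ℝ) * h ≤ s := by
  have h1 : ((⌊s / h⌋₊ : ℝ≥0)) ≤ s / h := Nat.floor_le (zero_le)
  rw [le_div_iff₀ hh] at h1
  exact_mod_cast h1

theorem lt_floor_div_mul_add (s : ℝ≥0) {h : ℝ≥0} (hh : 0 < h) :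
    (s : ℝ) < (⌊s / h⌋₊ : ℝ) * h + h := by
  have h1 : s / h < ⌊s / h⌋₊ + 1 := Nat.lt_floor_add_one _
  rw [div_lt_iff₀ hh] at h1
  have : (s : ℝ) < ((⌊s / h⌋₊ : ℝ) + 1) * h := by exact_mod_cast h1
  linarith

theorem eventually_eventually_norm_pow_sub_smul_le (h0 : F 0 = 1) (hF : IsLocallyStable F)
    (hG : ∀ p ∈ G, HasDerivZero F p.1 p.2) (hd : Dense (Prod.fst '' G)) {x z : E}
    (hxz : (x, z) ∈ closure G) {ε : ℝ} (hε : 0 < ε) :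
    ∀ᶠ δ : ℝ≥0 in 𝓝[>] 0, ∀ᶠ h : ℝ≥0 in 𝓝[>] 0, ∀ m : ℕ,
      |(m : ℝ) * h - δ| ≤ h → ‖(F h ^ m) x - x - (δ : ℝ) • z‖ ≤ ε * δ := by
  obtain ⟨δ₀, hδ₀, H⟩ := eventually_norm_pow_sub_smul_le h0 hF hG hd hxz hε
  filter_upwards [eventually_coe_lt hδ₀, self_mem_nhdsWithin] with δ h1 (h2 : 0 < δ)
  exact H δ h2 h1.le

/-- Stability and consistency imply convergence: the powers `F(h)^⌊τ/h⌋` converge along any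
solution of the Cauchy problem for the closure of `G`. -/
theorem tendsto_pow_floor_of_hasRightDeriv (h0 : F 0 = 1) (hF : IsLocallyStable F)
    (hG : ∀ p ∈ G, HasDerivZero F p.1 p.2) (hd : Dense (Prod.fst '' G)) {y v : ℝ≥0 → E}
    (hy : Continuous y) (hyv : ∀ s, (y s, v s) ∈ closure G)
    (hder : ∀ s, HasRightDeriv y s (v s)) {h : ℕ → ℝ≥0} (hh : Tendsto h atTop (𝓝[>] 0))
    (τ : ℝ≥0) : Tendsto (fun n => (F (h n) ^ ⌊τ / h n⌋₊) (y 0)) atTop (𝓝 (y τ)) := by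
  obtain ⟨K, hK1, hK⟩ := hF τ
  have hpos : ∀ᶠ n in atTop, 0 < h n := hh.eventually self_mem_nhdsWithin
  -- `w n` joins the approximation of the solution at time `τ` (at `s = 0`) to the exact value `y τ`
  -- (at `s = τ`). It remains to show that it is asymptotically constant.
  set w : ℕ → ℝ≥0 → E := fun n s => (F (h n) ^ ⌊(τ - s) / h n⌋₊) (y s) with hw
  have hfl : ∀ (s g : ℝ≥0), 0 < g → (⌊(τ - s) / g⌋₊ : ℝ) * g ≤ τ := fun s g hg =>
    (floor_div_mul_le _ hg).trans (by exact_mod_cast tsub_le_self)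
  have hequi : ∀ s ≤ τ, ∀ η : ℝ, 0 < η → ∃ δ : ℝ, 0 < δ ∧ ∀ s' ≤ τ, dist s s' < δ →
      ∀ᶠ n in atTop, ‖w n s' - w n s‖ ≤ η := by
    intro s hs η hη
    obtain ⟨δ₁, hδ₁, H₁⟩ := eventually_norm_pow_sub_pow_le h0 hF hG hd (y s) τ
      (ε := η / 2) (by positivity)
    obtain ⟨δ₂, hδ₂, H₂⟩ := Metric.continuousAt_iff.1 hy.continuousAt (η / (2 * K))
      (by positivity)
    refine ⟨min (δ₁ / 2) δ₂, by positivity, fun s' hs' hd' => ?_⟩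
    have hd1 := hd'.trans_le (min_le_left _ _)
    have hd2 := hd'.trans_le (min_le_right _ _)
    filter_upwards [hpos, hh.eventually H₁,
      hh.eventually (eventually_coe_lt (δ := δ₁ / 2) (by positivity))] with n hn h1 h2
    have e : w n s' - w n s = (F (h n) ^ ⌊(τ - s') / h n⌋₊) (y s' - y s) +
        ((F (h n) ^ ⌊(τ - s') / h n⌋₊) (y s) - (F (h n) ^ ⌊(τ - s) / h n⌋₊) (y s)) := by
      simp only [hw, map_sub]; abel
    rw [e]
    refine (norm_add_le _ _).trans ?_
    have a1 : ‖(F (h n) ^ ⌊(τ - s') / h n⌋₊) (y s' - y s)‖ ≤ η / 2 := by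
      refine ((F (h n) ^ _).le_of_opNorm_le (hK _ hn _ (hfl s' _ hn)) _).trans ?_
      have := (H₂ (x := s') (by rwa [dist_comm])).le
      rw [dist_eq_norm] at this
      calc K * ‖y s' - y s‖ ≤ K * (η / (2 * K)) := by gcongr
        _ = η / 2 := by field_simp
    have a2 := h1 ⌊(τ - s') / h n⌋₊ ⌊(τ - s) / h n⌋₊ (hfl _ _ hn) (hfl _ _ hn) <| by
      have b1 := floor_div_mul_le (τ - s') hn
      have b2 := floor_div_mul_le (τ - s) hn
      have b3 := lt_floor_div_mul_add (τ - s') hn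
      have b4 := lt_floor_div_mul_add (τ - s) hn
      rw [NNReal.coe_sub hs] at b2 b4
      rw [NNReal.coe_sub hs'] at b1 b3
      rw [NNReal.dist_eq, abs_lt] at hd1
      rw [abs_le]
      constructor <;> linarith
    linarith
  -- A mean value inequality by continuous induction on `[0, τ]`: `hequi` makes the set of good
  -- times closed, and first order consistency extends it to the right. The slack `η` allows the
  -- limit in `n` to be taken separately at each time.
  have main : ∀ ε : ℝ, 0 < ε → ∀ s ∈ Set.Icc 0 τ, ∀ η : ℝ, 0 < η →
      ∀ᶠ n in atTop, ‖w n s - w n 0‖ ≤ ε * s + η := by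
    intro ε hε
    set S : Set ℝ≥0 := {s | ∀ η : ℝ, 0 < η → ∀ᶠ n in atTop, ‖w n s - w n 0‖ ≤ ε * s + η} with hS
    suffices Set.Icc 0 τ ⊆ S from this
    apply IsClosed.Icc_subset_of_forall_exists_gt
    · refine isClosed_of_closure_subset fun s hs => ?_
      have hsI : s ∈ Set.Icc 0 τ :=
        (isClosed_Icc.closure_subset_iff.2 Set.inter_subset_right) hs
      refine ⟨fun η hη => ?_, hsI⟩
      obtain ⟨δ, hδ, H⟩ := hequi s hsI.2 (η / 3) (by positivity)
      obtain ⟨s', ⟨hs'S, hs'I⟩, hs'⟩ := Metric.mem_closure_iff.1 hs (min δ (η / (3 * ε)))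
        (by positivity)
      have hd1 := hs'.trans_le (min_le_left _ _)
      have hd2 := hs'.trans_le (min_le_right _ _)
      filter_upwards [H s' hs'I.2 hd1, hs'S (η / 3) (by positivity)] with n h1 h2
      rw [NNReal.dist_eq, abs_lt] at hd2
      have h3 : ε * s' ≤ ε * s + η / 3 := by
        have : ε * s' ≤ ε * (s + η / (3 * ε)) := by gcongr; linarith
        have h4 : ε * (η / (3 * ε)) = η / 3 := by field_simp
        linarith
      have h5 := norm_sub_le_norm_sub_add_norm_sub (w n s) (w n s') (w n 0)
      rw [norm_sub_rev (w n s) (w n s')] at h5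
      linarith
    · intro η hη
      simp [hη.le]
    · rintro s ⟨hsS, hsI⟩ b (hb : s < b)
      have hsτ : s < τ := hsI.2
      have hlt : ∀ c, s < c → ∀ᶠ δ : ℝ≥0 in 𝓝[>] 0, s + δ ≤ c := by
        intro c hc
        have h1 : (0 : ℝ) < c - s := sub_pos.2 hc
        filter_upwards [eventually_coe_lt h1] with δ hδ
        have : (s : ℝ) + δ ≤ c := by linarith
        exact_mod_cast this
      obtain ⟨δ, hδ1, hδ2, hδ3, hδ4, hδ0⟩ := ((hder s (ε / (2 * K)) (by positivity)).and
        ((eventually_eventually_norm_pow_sub_smul_le h0 hF hG hd (hyv s)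
          (ε := ε / (2 * K)) (by positivity)).and
        ((hlt b hb).and ((hlt τ hsτ).and self_mem_nhdsWithin)))).exists
      replace hδ0 : 0 < δ := hδ0
      refine ⟨s + δ, fun η hη => ?_, lt_add_of_pos_right s hδ0, hδ3⟩
      filter_upwards [hsS η hη, hh.eventually hδ2, hpos] with n h1 h2 hn
      have hle : ⌊(τ - (s + δ)) / h n⌋₊ ≤ ⌊(τ - s) / h n⌋₊ := by
        gcongr
        exact le_self_add
      obtain ⟨m, hm⟩ := Nat.exists_eq_add_of_le hle
      have hmδ : |(m : ℝ) * h n - δ| ≤ h n := by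
        have b1 := floor_div_mul_le (τ - (s + δ)) hn
        have b2 := floor_div_mul_le (τ - s) hn
        have b3 := lt_floor_div_mul_add (τ - (s + δ)) hn
        have b4 := lt_floor_div_mul_add (τ - s) hn
        rw [NNReal.coe_sub hsτ.le, hm] at b2 b4
        rw [NNReal.coe_sub hδ4] at b1 b3
        push_cast at b1 b2 b3 b4
        rw [abs_le]
        constructor <;> linarith
      -- Moving from `s` to `s + δ` trades `m ≈ δ / h n` steps of `F` for an increment of `y`; both
      -- equal `δ • v s` to first order and cancel.
      have e : w n (s + δ) - w n s = (F (h n) ^ ⌊(τ - (s + δ)) / h n⌋₊)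
          ((y (s + δ) - y s - (δ : ℝ) • v s) -
            ((F (h n) ^ m) (y s) - y s - (δ : ℝ) • v s)) := by
        simp only [hw]
        rw [hm, pow_add, mul_apply_eq_comp, ← map_sub]
        congr 1
        abel
      have a1 : ‖w n (s + δ) - w n s‖ ≤ ε * δ := by
        rw [e]
        refine ((F (h n) ^ _).le_of_opNorm_le (hK _ hn _ (hfl _ _ hn)) _).trans ?_
        calc _ ≤ K * (ε / (2 * K) * δ + ε / (2 * K) * δ) := by
              gcongr
              exact (norm_sub_le _ _).trans (add_le_add hδ1 (h2 m hmδ))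
          _ = ε * δ := by field_simp; ring
      have a2 := norm_sub_le_norm_sub_add_norm_sub (w n (s + δ)) (w n s) (w n 0)
      push_cast
      linarith
  rw [Metric.tendsto_nhds]
  intro ε hε
  filter_upwards [main (ε / (4 * (τ + 1))) (by positivity) τ ⟨zero_le, le_rfl⟩ (ε / 4)
    (by positivity)] with n hn
  have e1 : w n τ = y τ := by simp [hw]
  have e2 : w n 0 = (F (h n) ^ ⌊τ / h n⌋₊) (y 0) := by simp only [hw, tsub_zero]
  rw [e1, e2] at hn
  rw [dist_comm, dist_eq_norm]
  have : ε / (4 * (τ + 1)) * τ ≤ ε / 4 := by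
    rw [div_mul_eq_mul_div, div_le_div_iff₀ (by positivity) (by positivity)]
    nlinarith [τ.coe_nonneg]
  linarith

end

/-! ### Weak limits, diagonal sequences and duality. -/

section

variable {𝕜 : Type*} [RCLike 𝕜] {E : Type*} [NormedAddCommGroup E] [NormedSpace 𝕜 E]

/-- Cantor's diagonal argument for countably many sequences. -/
theorem exists_strictMono_forall_tendsto {α : Type*} [TopologicalSpace α] {c : ℕ → ℕ → α}
    (hc : ∀ i, ∀ σ : ℕ → ℕ, StrictMono σ → ∃ j : ℕ → ℕ, StrictMono j ∧ ∃ y,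
      Tendsto (fun k => c i (σ (j k))) atTop (𝓝 y)) :
    ∃ σ : ℕ → ℕ, StrictMono σ ∧ ∀ i, ∃ y, Tendsto (fun k => c i (σ k)) atTop (𝓝 y) := by
  choose! J hJ hJc using hc
  let τ : ℕ → ℕ → ℕ := fun n => Nat.rec id (fun i σ => σ ∘ J i σ) n
  have hsucc : ∀ i, τ (i + 1) = τ i ∘ J i (τ i) := fun i => rfl
  have hmono : ∀ i, StrictMono (τ i) := by
    intro i
    induction i with
    | zero => exact strictMono_id
    | succ i ih => rw [hsucc]; exact ih.comp (hJ i _ ih)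
  have hnest : ∀ i m, ∃ ρ : ℕ → ℕ, StrictMono ρ ∧ τ (i + m) = τ i ∘ ρ := by
    intro i m
    induction m with
    | zero => exact ⟨id, strictMono_id, rfl⟩
    | succ m ih =>
      obtain ⟨ρ, hρ, h⟩ := ih
      refine ⟨ρ ∘ J (i + m) (τ (i + m)), hρ.comp (hJ _ _ (hmono _)), ?_⟩
      rw [← add_assoc, hsucc, h]
      rfl
  refine ⟨fun k => τ k k, strictMono_nat_of_lt_succ fun k => ?_, fun i => ?_⟩
  · rw [hsucc]
    exact hmono k ((Nat.lt_succ_self k).trans_le ((hJ k _ (hmono k)).id_le (k + 1)))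
  · obtain ⟨y, hy⟩ := hJc i _ (hmono i)
    refine ⟨y, ?_⟩
    -- The `i`-th sequence converges along `τ (i + 1)`, and the diagonal is a subsequence of that
    -- one from index `i + 1` on.
    choose ρ hρ hρ' using hnest (i + 1)
    rw [← tendsto_add_atTop_iff_nat (i + 1)]
    have h1 : Tendsto (fun k => ρ k (k + (i + 1))) atTop atTop :=
      tendsto_atTop_mono (fun k => (Nat.le_add_right k (i + 1)).trans ((hρ k).id_le _)) tendsto_id
    refine (hy.comp h1).congr fun k => ?_
    have h2 := congrFun (hρ' k) (k + (i + 1))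
    rw [add_comm (i + 1) k] at h2
    change _ = c i (τ (k + (i + 1)) (k + (i + 1)))
    rw [h2]
    rfl

/-- Weak convergence of sequences, tested against all continuous functionals. -/
def TendstoWeakly (𝕜 : Type*) [RCLike 𝕜] {E : Type*} [NormedAddCommGroup E] [NormedSpace 𝕜 E]
    (c : ℕ → E) (y : E) : Prop :=
  ∀ φ : StrongDual 𝕜 E, Tendsto (fun n => φ (c n)) atTop (𝓝 (φ y))

theorem tendsto_toWeakSpace_iff {c : ℕ → E} {y : E} :
    Tendsto (fun n => toWeakSpace 𝕜 E (c n)) atTop (𝓝 (toWeakSpace 𝕜 E y)) ↔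
      TendstoWeakly 𝕜 c y := by
  refine WeakBilin.tendsto_iff_forall_eval_tendsto (B := (topDualPairing 𝕜 E).flip) ?_
  intro a b hab
  refine (SeparatingDual.eq_iff_forall_dual_eq (R := 𝕜)).2 fun g => ?_
  exact congrArg (fun u => u g) hab

namespace TendstoWeakly

theorem of_tendsto {c : ℕ → E} {y : E} (h : Tendsto c atTop (𝓝 y)) : TendstoWeakly 𝕜 c y :=
  fun φ => (φ.continuous.tendsto y).comp h

variable {c c' : ℕ → E} {y y' : E}

theorem comp (h : TendstoWeakly 𝕜 c y) {j : ℕ → ℕ} (hj : Tendsto j atTop atTop) :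
    TendstoWeakly 𝕜 (fun n => c (j n)) y :=
  fun φ => (h φ).comp hj

theorem add (h : TendstoWeakly 𝕜 c y) (h' : TendstoWeakly 𝕜 c' y') :
    TendstoWeakly 𝕜 (fun n => c n + c' n) (y + y') := fun φ => by
  simpa using (h φ).add (h' φ)

theorem sub (h : TendstoWeakly 𝕜 c y) (h' : TendstoWeakly 𝕜 c' y') :
    TendstoWeakly 𝕜 (fun n => c n - c' n) (y - y') := fun φ => by
  simpa using (h φ).sub (h' φ)

theorem const_smul (h : TendstoWeakly 𝕜 c y) (r : 𝕜) :
    TendstoWeakly 𝕜 (fun n => r • c n) (r • y) := fun φ => by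
  simpa using (h φ).const_mul r

theorem congr_of_tendsto_norm_sub (h : TendstoWeakly 𝕜 c y)
    (hc : Tendsto (fun n => ‖c n - c' n‖) atTop (𝓝 0)) : TendstoWeakly 𝕜 c' y := by
  have h1 := h.sub (of_tendsto (𝕜 := 𝕜) (tendsto_zero_iff_norm_tendsto_zero.2 hc))
  simpa using h1

/-- By Hahn–Banach. This is how norm estimates on the approximations pass to their weak limits. -/
theorem norm_le (h : TendstoWeakly 𝕜 c y) {r : ℝ} (hr : 0 ≤ r) (hc : ∀ᶠ n in atTop, ‖c n‖ ≤ r) :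
    ‖y‖ ≤ r := by
  refine NormedSpace.norm_le_dual_bound 𝕜 y hr fun φ => ?_
  refine le_of_tendsto (h φ).norm ?_
  filter_upwards [hc] with n hn
  rw [mul_comm]
  exact φ.le_of_opNorm_le_of_le le_rfl hn

theorem unique (h : TendstoWeakly 𝕜 c y) (h' : TendstoWeakly 𝕜 c y') : y = y' :=
  (SeparatingDual.eq_iff_forall_dual_eq (R := 𝕜)).2 fun φ => tendsto_nhds_unique (h φ) (h' φ)

end TendstoWeakly

/-- A sequence that is approximated, up to arbitrarily small errors in norm, by weakly convergent
sequences is itself weakly convergent. -/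
theorem exists_tendstoWeakly_of_approx [CompleteSpace E] {c : ℕ → E}
    (hc : ∀ η : ℝ, 0 < η → ∃ c' : ℕ → E, ∃ y, TendstoWeakly 𝕜 c' y ∧
      ∀ᶠ n in atTop, ‖c n - c' n‖ ≤ η) : ∃ y, TendstoWeakly 𝕜 c y := by
  have hpos : ∀ j : ℕ, (0 : ℝ) < 1 / (j + 1) := fun j => Nat.one_div_pos_of_nat
  choose c' y hy hcc using fun j : ℕ => hc (1 / (j + 1)) (hpos j)
  have hlim : Tendsto (fun j : ℕ => 1 / ((j : ℝ) + 1)) atTop (𝓝 0) :=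
    tendsto_one_div_add_atTop_nhds_zero_nat
  have hdist : ∀ i j, dist (y i) (y j) ≤ 1 / (i + 1) + 1 / (j + 1) := by
    intro i j
    rw [dist_eq_norm]
    refine ((hy i).sub (hy j)).norm_le (add_pos (hpos i) (hpos j)).le ?_
    filter_upwards [hcc i, hcc j] with n h1 h2
    have := norm_sub_le_norm_sub_add_norm_sub (c' i n) (c n) (c' j n)
    rw [norm_sub_rev (c' i n) (c n)] at this
    linarith
  have hcauchy : CauchySeq y := by
    refine cauchySeq_of_le_tendsto_0' (fun j : ℕ => 2 * (1 / ((j : ℝ) + 1))) (fun n m hnm => ?_)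
      (by simpa using hlim.const_mul 2)
    refine (hdist n m).trans ?_
    have : 1 / ((m : ℝ) + 1) ≤ 1 / (n + 1) := by gcongr
    linarith
  obtain ⟨y', hy'⟩ := cauchySeq_tendsto_of_complete hcauchy
  refine ⟨y', fun φ => ?_⟩
  rw [Metric.tendsto_nhds]
  intro ε hε
  have hη : 0 < ε / (4 * (‖φ‖ + 1)) := by positivity
  obtain ⟨j, hj1, hj2⟩ := ((hlim.eventually_lt_const hη).and
    (Metric.tendsto_nhds.1 hy' _ hη)).exists
  filter_upwards [hcc j, Metric.tendsto_nhds.1 (hy j φ) (ε / 4) (by positivity)] with n h1 h2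
  have key : ∀ x : E, ‖x‖ ≤ ε / (4 * (‖φ‖ + 1)) → ‖φ x‖ ≤ ε / 4 := by
    intro x hx
    refine (φ.le_of_opNorm_le_of_le le_rfl hx).trans ?_
    rw [mul_div_assoc', div_le_div_iff₀ (by positivity) (by positivity)]
    nlinarith [norm_nonneg φ]
  have k1 := key _ (h1.trans hj1.le)
  rw [dist_eq_norm] at hj2 h2 ⊢
  have k2 := key _ hj2.le
  have e : φ (c n) - φ y' = φ (c n - c' j n) + (φ (c' j n) - φ (y j)) + φ (y j - y') := by
    simp
  rw [e]
  refine norm_add₃_le.trans_lt ?_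
  linarith

theorem HasWeaklyConvergentSubsubsequences.of_tendsto_norm_sub {u w : ℕ → E}
    (hu : HasWeaklyConvergentSubsubsequences 𝕜 u)
    (h : Tendsto (fun n => ‖w n - u n‖) atTop (𝓝 0)) :
    HasWeaklyConvergentSubsubsequences 𝕜 w := by
  intro i hi
  obtain ⟨j, hj, y, hy⟩ := hu i hi
  refine ⟨j, hj, y, tendsto_toWeakSpace_iff.2 ?_⟩
  refine (tendsto_toWeakSpace_iff.1 hy).congr_of_tendsto_norm_sub ?_
  simp_rw [norm_sub_rev (u _)]
  exact h.comp (hi.comp hj).tendsto_atTop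

/-- Weak limits of orbits satisfy, in the sense of functionals in the domain of the derivative of
the adjoint family, the differential equation. -/
theorem apply_eq_apply_of_tendstoWeakly {F : ℝ≥0 → E →L[𝕜] E} (h0 : F 0 = 1) (hF : IsLocallyStable F)
    {φ ψ : StrongDual 𝕜 E} (hφ : HasDerivZero (adjointFun F) φ ψ) {x z : E}
    (hxz : HasDerivZero F x z) {h : ℕ → ℝ≥0} (hh : Tendsto h atTop (𝓝[>] 0)) {s : ℝ≥0} {y v : E}
    (hy : TendstoWeakly 𝕜 (fun n => (F (h n) ^ ⌊s / h n⌋₊) x) y)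
    (hv : TendstoWeakly 𝕜 (fun n => (F (h n) ^ ⌊s / h n⌋₊) z) v) : φ v = ψ y := by
  obtain ⟨K, hK1, hK⟩ := hF s
  set P : ℕ → E →L[𝕜] E := fun n => F (h n) ^ ⌊s / h n⌋₊ with hP
  have hPK : ∀ᶠ n in atTop, ‖P n‖ ≤ K := by
    filter_upwards [hh.eventually self_mem_nhdsWithin] with n (hn : 0 < h n)
    exact hK _ hn _ (floor_div_mul_le s hn)
  -- The same scalars are computed twice: with the difference quotient acting on `x` they tend to `φ
  -- v`, with its adjoint acting on `φ` they tend to `ψ y`. Commutation of `F (h n)` with `P n`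
  -- identifies the two.
  have h1 : Tendsto (fun n => φ (P n (((h n : ℝ) : 𝕜)⁻¹ • (F (h n) x - F 0 x)))) atTop
      (𝓝 (φ v)) := by
    have a1 : Tendsto (fun n => P n ((((h n : ℝ) : 𝕜)⁻¹ • (F (h n) x - F 0 x)) - z)) atTop
        (𝓝 0) := by
      have a2 := tendsto_zero_iff_norm_tendsto_zero.1
        (tendsto_sub_nhds_zero_iff.2 (hxz.comp hh))
      refine squeeze_zero_norm' ?_ (by simpa using a2.const_mul K)
      filter_upwards [hPK] with n hn
      exact (P n).le_of_opNorm_le hn _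
    have a3 := (TendstoWeakly.of_tendsto (𝕜 := 𝕜) a1).add hv φ
    rw [zero_add] at a3
    refine a3.congr fun n => ?_
    change φ (P n _ + P n z) = _
    rw [map_sub (P n), sub_add_cancel]
  have h2 : Tendsto (fun n => (((h n : ℝ) : 𝕜)⁻¹ •
      (adjointFun F (h n) φ - adjointFun F 0 φ)) (P n x)) atTop (𝓝 (ψ y)) := by
    have a1 : Tendsto (fun n => ((((h n : ℝ) : 𝕜)⁻¹ •
        (adjointFun F (h n) φ - adjointFun F 0 φ)) - ψ) (P n x)) atTop (𝓝 0) := by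
      have a2 := tendsto_zero_iff_norm_tendsto_zero.1
        (tendsto_sub_nhds_zero_iff.2 (hφ.comp hh))
      refine squeeze_zero_norm' ?_ (by simpa using a2.mul_const (K * ‖x‖))
      filter_upwards [hPK] with n hn
      exact ContinuousLinearMap.le_of_opNorm_le_of_le _ le_rfl ((P n).le_of_opNorm_le hn x)
    have a3 := a1.add (hy ψ)
    rw [zero_add] at a3
    refine a3.congr fun n => ?_
    rw [sub_apply, sub_add_cancel]
  refine tendsto_nhds_unique h1 (h2.congr fun n => ?_)
  have comm : F (h n) (P n x) = P n (F (h n) x) := by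
    simp only [hP, ← mul_apply_eq_comp, ← pow_succ, ← pow_succ']
  simp [adjointFun, h0, comm]

/-- Mazur's theorem: a point outside a closed convex set is strictly separated from it by a
functional, which no weak limit allows. -/
theorem mem_closure_of_tendstoWeakly [NormedSpace ℝ E] [IsScalarTower ℝ 𝕜 E]
    (G : Submodule 𝕜 (E × E)) {g : ℕ → E × E} (hg : ∀ n, g n ∈ G) {x z : E}
    (hx : TendstoWeakly 𝕜 (fun n => (g n).1) x) (hz : TendstoWeakly 𝕜 (fun n => (g n).2) z) :
    (x, z) ∈ closure (G : Set (E × E)) := by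
  by_contra hcon
  have hconv : Convex ℝ (G : Set (E × E)) := (G.restrictScalars ℝ).convex
  obtain ⟨ℓ, u, h1, h2⟩ := RCLike.geometric_hahn_banach_point_closed (𝕜 := 𝕜) hconv.closure
    isClosed_closure hcon
  have e : ∀ p : E × E, ℓ p = (ℓ.comp (ContinuousLinearMap.inl 𝕜 E E)) p.1 +
      (ℓ.comp (ContinuousLinearMap.inr 𝕜 E E)) p.2 := by
    intro p
    simp [← map_add]
  have h3 : Tendsto (fun n => RCLike.re (ℓ (g n))) atTop (𝓝 (RCLike.re (ℓ (x, z)))) := by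
    refine (RCLike.continuous_re.tendsto _).comp ?_
    simp_rw [e]
    exact (hx _).add (hz _)
  have h4 := ge_of_tendsto h3 (Eventually.of_forall fun n => (h2 _ (subset_closure (hg n))).le)
  linarith

/-- On `G` both sides are the limit of `φ` applied to the difference quotients of `F`, and the
relation is closed. It yields closability and identifies derivatives of weak limits. -/
theorem apply_snd_eq_apply_fst_of_mem_closure {F : ℝ≥0 → E →L[𝕜] E} {G : Set (E × E)}
    (hG : ∀ p ∈ G, HasDerivZero F p.1 p.2) {φ ψ : StrongDual 𝕜 E}
    (hφ : HasDerivZero (adjointFun F) φ ψ) {p : E × E} (hp : p ∈ closure G) : φ p.2 = ψ p.1 := by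
  have hclosed : IsClosed {p : E × E | φ p.2 = ψ p.1} :=
    isClosed_eq (by fun_prop) (by fun_prop)
  refine closure_minimal (fun p hp => ?_) hclosed hp
  have h1 := (φ.continuous.tendsto _).comp (hG p hp)
  have h2 := ((ContinuousLinearMap.apply 𝕜 𝕜 p.1).continuous.tendsto _).comp hφ
  refine tendsto_nhds_unique h1 (h2.congr fun h => ?_)
  simp [adjointFun]

end

/-! ### Weak limits of orbits solve the Cauchy problem. -/

section

variable {𝕜 : Type*} [RCLike 𝕜] {E : Type*} [NormedAddCommGroup E] [NormedSpace 𝕜 E]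
variable [NormedSpace ℝ E] [IsScalarTower ℝ 𝕜 E]
variable {F : ℝ≥0 → E →L[𝕜] E}

theorem abs_floor_div_sub_le (s r : ℝ≥0) {h : ℝ≥0} (hh : 0 < h) :
    |(⌊s / h⌋₊ : ℝ) * h - ⌊r / h⌋₊ * h| ≤ dist s r + h := by
  have b1 := floor_div_mul_le s hh
  have b2 := floor_div_mul_le r hh
  have b3 := lt_floor_div_mul_add s hh
  have b4 := lt_floor_div_mul_add r hh
  have b5 := abs_le.1 (NNReal.dist_eq s r).ge
  rw [abs_le]
  constructor <;> linarith [b5.1, b5.2]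

/-- Orbits `s ↦ F(h)^⌊s/h⌋ x` are asymptotically equicontinuous, locally uniformly in `s`. -/
theorem eventually_norm_pow_floor_sub_le {G : Set (E × E)} (h0 : F 0 = 1)
    (hF : IsLocallyStable F) (hG : ∀ p ∈ G, HasDerivZero F p.1 p.2) (hd : Dense (Prod.fst '' G))
    (x : E) (s : ℝ≥0) {ε : ℝ} (hε : 0 < ε) :
    ∃ δ : ℝ, 0 < δ ∧ ∀ r, dist s r < δ → ∀ᶠ h : ℝ≥0 in 𝓝[>] 0,
      ‖(F h ^ ⌊s / h⌋₊) x - (F h ^ ⌊r / h⌋₊) x‖ ≤ ε := by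
  obtain ⟨δ, hδ, H⟩ := eventually_norm_pow_sub_pow_le h0 hF hG hd x (s + 1) hε
  refine ⟨min 1 (δ / 2), by positivity, fun r hr => ?_⟩
  have hr1 := hr.trans_le (min_le_left _ _)
  have hr2 := hr.trans_le (min_le_right _ _)
  filter_upwards [H, self_mem_nhdsWithin, eventually_coe_lt (half_pos hδ)] with h h1 (hh : 0 < h) h2
  refine h1 _ _ ?_ ?_ ((abs_floor_div_sub_le s r hh).trans (by linarith))
  · linarith [floor_div_mul_le s hh]
  · rw [NNReal.dist_eq, abs_lt] at hr1
    linarith [floor_div_mul_le r hh]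

theorem continuous_of_tendstoWeakly_pow_floor {G : Set (E × E)} (h0 : F 0 = 1)
    (hF : IsLocallyStable F) (hG : ∀ p ∈ G, HasDerivZero F p.1 p.2) (hd : Dense (Prod.fst '' G))
    {h : ℕ → ℝ≥0} (hh : Tendsto h atTop (𝓝[>] 0)) {x : E} {y : ℝ≥0 → E}
    (hy : ∀ s, TendstoWeakly 𝕜 (fun n => (F (h n) ^ ⌊s / h n⌋₊) x) (y s)) : Continuous y := by
  rw [continuous_iff_continuousAt]
  intro s
  rw [Metric.continuousAt_iff]
  intro ε hε
  obtain ⟨δ, hδ, H⟩ := eventually_norm_pow_floor_sub_le h0 hF hG hd x s (half_pos hε)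
  refine ⟨δ, hδ, fun {r} hr => ?_⟩
  rw [dist_comm, dist_eq_norm]
  have := ((hy s).sub (hy r)).norm_le (half_pos hε).le
    (hh.eventually (H r (by rwa [dist_comm])))
  linarith

/-- If both `F(h)^⌊s/h⌋ x` and `F(h)^⌊s/h⌋ z` converge weakly, where `z` is the derivative of `F`
at `x`, then the limit of the former is right differentiable with derivative the latter. -/
theorem hasRightDeriv_of_tendstoWeakly {G : Set (E × E)} (h0 : F 0 = 1)
    (hF : IsLocallyStable F) (hG : ∀ p ∈ G, HasDerivZero F p.1 p.2) (hd : Dense (Prod.fst '' G))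
    {h : ℕ → ℝ≥0} (hh : Tendsto h atTop (𝓝[>] 0)) {x z : E} (hxz : (x, z) ∈ closure G)
    {y v : ℝ≥0 → E}
    (hy : ∀ s, TendstoWeakly 𝕜 (fun n => (F (h n) ^ ⌊s / h n⌋₊) x) (y s))
    (hv : ∀ s, TendstoWeakly 𝕜 (fun n => (F (h n) ^ ⌊s / h n⌋₊) z) (v s)) (s : ℝ≥0) :
    HasRightDeriv y s (v s) := by
  intro ε hε
  obtain ⟨K, hK1, hK⟩ := hF s
  filter_upwards [eventually_eventually_norm_pow_sub_smul_le h0 hF hG hd hxz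
    (ε := ε / K) (by positivity)] with δ hδ
  rw [RCLike.real_smul_eq_coe_smul (K := 𝕜)]
  refine (((hy (s + δ)).sub (hy s)).sub ((hv s).const_smul ((δ : ℝ) : 𝕜))).norm_le (by positivity) ?_
  filter_upwards [hh.eventually hδ, hh.eventually self_mem_nhdsWithin] with n h1 (hn : 0 < h n)
  obtain ⟨m, hm⟩ := Nat.exists_eq_add_of_le
    (show ⌊s / h n⌋₊ ≤ ⌊(s + δ) / h n⌋₊ by gcongr; exact le_self_add)
  have e : (F (h n) ^ ⌊(s + δ) / h n⌋₊) x - (F (h n) ^ ⌊s / h n⌋₊) x -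
      ((δ : ℝ) : 𝕜) • (F (h n) ^ ⌊s / h n⌋₊) z =
      (F (h n) ^ ⌊s / h n⌋₊) ((F (h n) ^ m) x - x - (δ : ℝ) • z) := by
    rw [hm, pow_add, mul_apply_eq_comp, ← map_smul, ← map_sub, ← map_sub,
      RCLike.real_smul_eq_coe_smul (K := 𝕜)]
  rw [e]
  refine ((F (h n) ^ _).le_of_opNorm_le (hK _ hn _ (floor_div_mul_le s hn)) _).trans ?_
  have hmδ : |(m : ℝ) * h n - δ| ≤ h n := by
    have b1 := floor_div_mul_le (s + δ) hn
    have b2 := floor_div_mul_le s hn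
    have b3 := lt_floor_div_mul_add (s + δ) hn
    have b4 := lt_floor_div_mul_add s hn
    rw [hm] at b1 b3
    push_cast at b1 b3
    rw [abs_le]
    constructor <;> linarith
  calc K * _ ≤ K * (ε / K * δ) := by gcongr; exact h1 m hmδ
    _ = ε * δ := by field_simp

/-- Along one subsequence, the orbits of all elements of the closure of a countable set converge
weakly at all times. -/
theorem exists_strictMono_forall_tendstoWeakly [CompleteSpace E] {G : Set (E × E)} (h0 : F 0 = 1)
    (hF : IsLocallyStable F) (hG : ∀ p ∈ G, HasDerivZero F p.1 p.2) (hd : Dense (Prod.fst '' G))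
    {h : ℕ → ℝ≥0} (hh : Tendsto h atTop (𝓝[>] 0)) (a : ℕ → E)
    (ha : ∀ i s, HasWeaklyConvergentSubsubsequences 𝕜
      (fun n => (F (h n) ^ ⌊s / h n⌋₊) (a i))) :
    ∃ σ : ℕ → ℕ, StrictMono σ ∧ ∀ x ∈ closure (Set.range a), ∀ s, ∃ y,
      TendstoWeakly 𝕜 (fun n => (F (h (σ n)) ^ ⌊s / h (σ n)⌋₊) x) y := by
  let q : ℕ → ℝ≥0 := TopologicalSpace.denseSeq ℝ≥0
  obtain ⟨σ, hσ, H⟩ := exists_strictMono_forall_tendsto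
    (c := fun i n => toWeakSpace 𝕜 E ((F (h n) ^ ⌊q i.unpair.2 / h n⌋₊) (a i.unpair.1)))
    (fun i σ hσ => by
      obtain ⟨j, hj, y, hy⟩ := ha i.unpair.1 (q i.unpair.2) σ hσ
      exact ⟨j, hj, _, hy⟩)
  refine ⟨σ, hσ, fun x hx s => ?_⟩
  have hhσ : Tendsto (fun n => h (σ n)) atTop (𝓝[>] 0) := hh.comp hσ.tendsto_atTop
  -- The diagonal sequence handles only the `a i` at a countable dense set of times. Equicontinuity
  -- reaches the other times, stability the other elements.
  refine exists_tendstoWeakly_of_approx fun η hη => ?_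
  obtain ⟨δ, hδ, Hδ⟩ := eventually_norm_pow_floor_sub_le h0 hF hG hd x s (half_pos hη)
  obtain ⟨k, hk⟩ := (TopologicalSpace.denseRange_denseSeq ℝ≥0).exists_dist_lt s hδ
  obtain ⟨K, hK1, hK⟩ := hF (q k)
  obtain ⟨_, ⟨i, rfl⟩, hi⟩ := Metric.mem_closure_iff.1 hx (η / (2 * K)) (by positivity)
  obtain ⟨y, hy⟩ := H (Nat.pair i k)
  simp only [Nat.unpair_pair] at hy
  refine ⟨_, (toWeakSpace 𝕜 E).symm y, tendsto_toWeakSpace_iff.1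
    (by simpa only [LinearEquiv.apply_symm_apply] using hy), ?_⟩
  filter_upwards [hhσ.eventually (Hδ (q k) hk), hhσ.eventually self_mem_nhdsWithin]
    with n h1 (hn : 0 < h (σ n))
  have h2 : ‖(F (h (σ n)) ^ ⌊q k / h (σ n)⌋₊) (x - a i)‖ ≤ η / 2 := by
    refine ((F (h (σ n)) ^ _).le_of_opNorm_le
      (hK _ hn _ (floor_div_mul_le (q k) hn)) _).trans ?_
    rw [dist_eq_norm] at hi
    calc K * ‖x - a i‖ ≤ K * (η / (2 * K)) := by gcongr
      _ = η / 2 := by field_simp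
  rw [map_sub] at h2
  have := norm_sub_le_norm_sub_add_norm_sub ((F (h (σ n)) ^ ⌊s / h (σ n)⌋₊) x)
    ((F (h (σ n)) ^ ⌊q k / h (σ n)⌋₊) x) ((F (h (σ n)) ^ ⌊q k / h (σ n)⌋₊) (a i))
  linarith

/-- Existence of solutions of the Cauchy problem for initial values in the set on which the
approximants are controlled. -/
theorem exists_hasRightDeriv [CompleteSpace E] {G : Submodule 𝕜 (E × E)} (h0 : F 0 = 1)
    (hF : IsLocallyStable F) (hG : ∀ p ∈ G, HasDerivZero F p.1 p.2)
    {B : Set (StrongDual 𝕜 E)} (hB : ∀ φ ∈ B, ∃ ψ, HasDerivZero (adjointFun F) φ ψ)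
    (hsep : ∀ x : E, (∀ φ ∈ B, φ x = 0) → x = 0) {h : ℕ → ℝ≥0} (hh : Tendsto h atTop (𝓝[>] 0))
    {A : Set E} (hA : Dense A) (hAG : ∀ f ∈ A, ∃ z, (f, z) ∈ G)
    (happ : ∀ f ∈ A, ∀ s : ℝ≥0, ∃ g : ℕ → E × E, (∀ n, g n ∈ G) ∧
      Tendsto (fun n => ‖(F (h n) ^ ⌊s / h n⌋₊) f - (g n).1‖) atTop (𝓝 0) ∧
      HasWeaklyConvergentSubsubsequences 𝕜 (fun n => (g n).1) ∧
      HasWeaklyConvergentSubsubsequences 𝕜 (fun n => (g n).2)) {f : E} (hf : f ∈ A) :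
    ∃ y v : ℝ≥0 → E, y 0 = f ∧ Continuous y ∧ Continuous v ∧
      (∀ s, (y s, v s) ∈ closure (G : Set (E × E))) ∧ ∀ s, HasRightDeriv y s (v s) := by
  have hd : Dense (Prod.fst '' (G : Set (E × E))) := hA.mono fun f hf => by
    obtain ⟨z, hz⟩ := hAG f hf
    exact ⟨_, hz, rfl⟩
  obtain ⟨z, hz⟩ := hAG f hf
  obtain ⟨b, hbA, hb⟩ := mem_closure_iff_seq_limit.1 (hA z)
  -- The derivative `z` of `F` at `f` need not lie in `A`, so its orbits are reached through a
  -- sequence `b` in `A` tending to `z`.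
  let a : ℕ → E := fun n => Nat.casesOn n f b
  have haA : ∀ i, a i ∈ A := fun i => by
    cases i with
    | zero => exact hf
    | succ i => exact hbA i
  have haz : z ∈ closure (Set.range a) :=
    mem_closure_of_tendsto hb (Eventually.of_forall fun n => ⟨n + 1, rfl⟩)
  obtain ⟨σ, hσ, H⟩ := exists_strictMono_forall_tendstoWeakly h0 hF hG hd hh a fun i s => by
    obtain ⟨g, -, h1, h2, -⟩ := happ (a i) (haA i) s
    exact h2.of_tendsto_norm_sub h1
  have hhσ : Tendsto (fun n => h (σ n)) atTop (𝓝[>] 0) := hh.comp hσ.tendsto_atTop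
  choose y hy using H f (subset_closure ⟨0, rfl⟩)
  choose v hv using H z haz
  refine ⟨y, v, ?_, continuous_of_tendstoWeakly_pow_floor h0 hF hG hd hhσ hy,
    continuous_of_tendstoWeakly_pow_floor h0 hF hG hd hhσ hv, fun s => ?_,
    hasRightDeriv_of_tendstoWeakly h0 hF hG hd hhσ (subset_closure hz) hy hv⟩
  · refine (hy 0).unique (TendstoWeakly.of_tendsto (𝕜 := 𝕜) ?_)
    simp
  · obtain ⟨g, hgG, h1, -, h3⟩ := happ f hf s
    obtain ⟨j, hj, w, hw⟩ := h3 σ hσ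
    have hmem : (y s, w) ∈ closure (G : Set (E × E)) :=
      mem_closure_of_tendstoWeakly G (g := fun k => g (σ (j k))) (fun k => hgG _)
        (((hy s).comp hj.tendsto_atTop).congr_of_tendsto_norm_sub
          (h1.comp (hσ.comp hj).tendsto_atTop)) (tendsto_toWeakSpace_iff.1 hw)
    have hwv : w = v s := by
      refine sub_eq_zero.1 (hsep _ fun φ hφ => ?_)
      obtain ⟨ψ, hψ⟩ := hB φ hφ
      rw [map_sub, apply_eq_apply_of_tendstoWeakly h0 hF hψ (hG _ hz) hhσ (hy s) (hv s),
        apply_snd_eq_apply_fst_of_mem_closure hG hψ hmem, sub_self]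
    rwa [← hwv]

end

/-! ### Semigroups, their generators and solutions of the Cauchy problem. -/

section

variable {𝕜 : Type*} [RCLike 𝕜] {E : Type*} [NormedAddCommGroup E] [NormedSpace 𝕜 E]

theorem exists_tendsto_of_dense [CompleteSpace E] {P : ℕ → E →L[𝕜] E} {K : ℝ}
    (hP : ∀ᶠ n in atTop, ‖P n‖ ≤ K) {A : Set E} (hA : Dense A)
    (h : ∀ f ∈ A, ∃ l, Tendsto (fun n => P n f) atTop (𝓝 l)) (x : E) :
    ∃ l, Tendsto (fun n => P n x) atTop (𝓝 l) := by
  refine cauchySeq_tendsto_of_complete (Metric.cauchySeq_iff.2 fun ε hε => ?_)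
  obtain ⟨f, hf, hxf⟩ := hA.exists_dist_lt x (ε := ε / (4 * (|K| + 1))) (by positivity)
  obtain ⟨l, hl⟩ := h f hf
  obtain ⟨N, hN⟩ := eventually_atTop.1
    (hP.and (Metric.tendsto_nhds.1 hl (ε / 4) (by positivity)))
  have key : ∀ n ≥ N, dist (P n x) l < ε / 2 := by
    intro n hn
    obtain ⟨h1, h2⟩ := hN n hn
    have h3 : dist (P n x) (P n f) ≤ ε / 4 := by
      rw [dist_eq_norm, ← map_sub]
      rw [dist_eq_norm] at hxf
      refine ((P n).le_of_opNorm_le_of_le (h1.trans (le_abs_self K)) hxf.le).trans ?_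
      rw [mul_div_assoc', div_le_div_iff₀ (by positivity) (by positivity)]
      nlinarith [abs_nonneg K]
    linarith [dist_triangle (P n x) (P n f) l]
  refine ⟨N, fun m hm n hn => ?_⟩
  linarith [dist_triangle_right (P m x) (P n x) l, key m hm, key n hn]

theorem tendsto_apply_of_dense {P : ℕ → E →L[𝕜] E} {T : E →L[𝕜] E} {K : ℝ}
    (hP : ∀ᶠ n in atTop, ‖P n‖ ≤ K) {A : Set E} (hA : Dense A)
    (h : ∀ f ∈ A, Tendsto (fun n => P n f) atTop (𝓝 (T f))) (x : E) :
    Tendsto (fun n => P n x) atTop (𝓝 (T x)) := by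
  rw [Metric.tendsto_nhds]
  intro ε hε
  obtain ⟨f, hf, hxf⟩ := hA.exists_dist_lt x (ε := ε / (4 * (|K| + ‖T‖ + 1))) (by positivity)
  rw [dist_eq_norm] at hxf
  filter_upwards [hP, Metric.tendsto_nhds.1 (h f hf) (ε / 4) (by positivity)] with n h1 h2
  have key : ∀ Q : E →L[𝕜] E, ‖Q‖ ≤ |K| + ‖T‖ → dist (Q x) (Q f) ≤ ε / 4 := by
    intro Q hQ
    rw [dist_eq_norm, ← map_sub]
    refine (Q.le_of_opNorm_le_of_le hQ hxf.le).trans ?_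
    rw [mul_div_assoc', div_le_div_iff₀ (by positivity) (by positivity)]
    nlinarith [abs_nonneg K, norm_nonneg T]
  have k1 := key (P n) (h1.trans ((le_abs_self K).trans (by simp)))
  have k2 := key T (by simp)
  rw [dist_comm] at k2
  linarith [dist_triangle4 (P n x) (P n f) (T f) (T x)]

/-- The product of two families that are right differentiable at zero. -/
theorem HasDerivZero.mul {S R : ℝ≥0 → E →L[𝕜] E} (hS0 : S 0 = 1) (hR0 : R 0 = 1) {K : ℝ}
    (hS : ∀ᶠ h in 𝓝[>] 0, ‖S h‖ ≤ K) {x y z : E} (hx : HasDerivZero R x y)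
    (hx' : HasDerivZero S x z) (hy : Tendsto (fun h => S h y) (𝓝[>] 0) (𝓝 y)) :
    HasDerivZero (fun h => S h * R h) x (y + z) := by
  have h1 : Tendsto (fun h : ℝ≥0 => S h ((((h : ℝ) : 𝕜)⁻¹ • (R h x - R 0 x)) - y)) (𝓝[>] 0)
      (𝓝 0) := by
    have a2 := tendsto_zero_iff_norm_tendsto_zero.1 (tendsto_sub_nhds_zero_iff.2 hx)
    refine squeeze_zero_norm' ?_ (by simpa using a2.const_mul K)
    filter_upwards [hS] with h hh using (S h).le_of_opNorm_le hh _
  have h2 := (h1.add hy).add hx'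
  rw [zero_add] at h2
  refine h2.congr fun h => ?_
  simp only [map_sub, map_smul, sub_add_cancel, hS0, hR0, mul_apply_eq_comp, mul_one,
    one_apply_eq_self, ← smul_add, sub_add_sub_cancel]

theorem IsC0Semigroup.eventually_norm_le {T : ℝ≥0 → E →L[𝕜] E} (hT : IsC0Semigroup T) :
    ∃ K, ∀ᶠ h in 𝓝[>] 0, ‖T h‖ ≤ K := by
  obtain ⟨M, a, hM, H⟩ := hT.exists_bound
  have : Tendsto (fun s : ℝ≥0 => M * Real.exp (a * s)) (𝓝 0) (𝓝 (M * Real.exp (a * (0 : ℝ≥0)))) :=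
    Continuous.tendsto (by fun_prop) _
  have h2 := (this.mono_left (nhdsWithin_le_nhds (s := Set.Ioi 0))).eventually_le_const
    (u := M + 1) (by simp)
  exact ⟨M + 1, h2.mono fun h hh => (H h).trans hh⟩

theorem IsC0Semigroup.hasDerivZero_apply {T : ℝ≥0 → E →L[𝕜] E} (hT : IsC0Semigroup T) {x z : E}
    (h : HasDerivZero T x z) (s : ℝ≥0) : HasDerivZero T (T s x) (T s z) := by
  refine (((T s).continuous.tendsto z).comp h).congr fun δ => ?_
  have : T δ (T s x) = T s (T δ x) := by
    rw [← mul_apply_eq_comp, ← mul_apply_eq_comp, ← hT.map_add, ← hT.map_add, add_comm]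
  simp [this, hT.map_zero]

variable [NormedSpace ℝ E] [IsScalarTower ℝ 𝕜 E]

theorem IsC0Semigroup.hasRightDeriv {T : ℝ≥0 → E →L[𝕜] E} (hT : IsC0Semigroup T) {x z : E}
    (h : HasDerivZero T x z) (s : ℝ≥0) : HasRightDeriv (fun s => T s x) s (T s z) := by
  intro ε hε
  filter_upwards [(hasDerivZero_iff hT.map_zero).1 h (ε / (‖T s‖ + 1)) (by positivity)] with δ hδ
  have e : T (s + δ) x - T s x - (δ : ℝ) • T s z = T s (T δ x - x - (δ : ℝ) • z) := by
    rw [hT.map_add, mul_apply_eq_comp, map_sub, map_sub, RCLike.real_smul_eq_coe_smul (K := 𝕜),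
      RCLike.real_smul_eq_coe_smul (K := 𝕜), map_smul]
  rw [e]
  calc _ ≤ (‖T s‖ + 1) * (ε / (‖T s‖ + 1) * δ) :=
        (T s).le_of_opNorm_le_of_le (by simp) hδ
    _ = ε * δ := by field_simp

theorem HasRightDeriv.hasDerivWithinAt {y : ℝ≥0 → E} {s : ℝ≥0} {z : E}
    (h : HasRightDeriv y s z) :
    HasDerivWithinAt (fun r : ℝ => y r.toNNReal) z (Set.Ioi (s : ℝ)) s := by
  rw [hasDerivWithinAt_iff_isLittleO, Asymptotics.isLittleO_iff]
  intro ε hε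
  have ht : Tendsto (fun r : ℝ => (r - s).toNNReal) (𝓝[>] (s : ℝ)) (𝓝[>] 0) := by
    refine tendsto_nhdsWithin_iff.2 ⟨?_, ?_⟩
    · have : Continuous fun r : ℝ => (r - s).toNNReal := by fun_prop
      have h2 := this.tendsto (s : ℝ)
      simp only [sub_self, Real.toNNReal_zero] at h2
      exact h2.mono_left nhdsWithin_le_nhds
    · filter_upwards [self_mem_nhdsWithin] with r (hr : (s : ℝ) < r)
      simpa using hr
  filter_upwards [ht.eventually (h ε hε), self_mem_nhdsWithin] with r h1 (hr : (s : ℝ) < r)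
  have e : s + (r - s).toNNReal = r.toNNReal := by
    rw [← NNReal.coe_inj, NNReal.coe_add, Real.coe_toNNReal _ (by linarith),
      Real.coe_toNNReal _ (by linarith [s.coe_nonneg])]
    ring
  rw [e, Real.coe_toNNReal _ (by linarith)] at h1
  rw [Real.norm_of_nonneg (by linarith), Real.toNNReal_coe]
  exact h1

/-- The average of a curve in a closed convex set stays in the set; a subspace also admits
multiplication by the length `δ`. -/
theorem intervalIntegral_mem_of_isClosed [CompleteSpace E] (Γ : Submodule ℝ (E × E))
    (hΓ : IsClosed (Γ : Set (E × E))) {y v : ℝ → E} (hy : Continuous y) (hv : Continuous v)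
    (h : ∀ r, (y r, v r) ∈ Γ) {δ : ℝ} (hδ : 0 < δ) :
    (∫ r in (0 : ℝ)..δ, y r, ∫ r in (0 : ℝ)..δ, v r) ∈ Γ := by
  have hc : Continuous fun r => (y r, v r) := hy.prodMk hv
  have h1 : (⨍ r in Set.Ioc 0 δ, (y r, v r)) ∈ (Γ : Set (E × E)) :=
    Γ.convex.set_average_mem hΓ (by simp [hδ]) (by simp) (Eventually.of_forall h)
      ((hc.integrableOn_Icc (a := 0) (b := δ)).mono_set Set.Ioc_subset_Icc_self)
  rw [MeasureTheory.setAverage_eq] at h1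
  have h2 := Γ.smul_mem δ h1
  rw [smul_smul] at h2
  have h3 : δ * (MeasureTheory.volume.real (Set.Ioc 0 δ))⁻¹ = 1 := by
    simp [MeasureTheory.measureReal_def, hδ.le, hδ.ne']
  rw [h3, one_smul, integral_pair
    ((hy.integrableOn_Icc (a := 0) (b := δ)).mono_set Set.Ioc_subset_Icc_self)
    ((hv.integrableOn_Icc (a := 0) (b := δ)).mono_set Set.Ioc_subset_Icc_self)] at h2
  rwa [intervalIntegral.integral_of_le hδ.le, intervalIntegral.integral_of_le hδ.le]

/-- A closed operator whose Cauchy problem is solved by the semigroup `T` for a dense set of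
initial values extends the generator of `T`. -/
theorem IsC0Semigroup.mem_of_hasDerivZero [CompleteSpace E] {T : ℝ≥0 → E →L[𝕜] E}
    (hT : IsC0Semigroup T) (Γ : Submodule 𝕜 (E × E)) (hΓ : IsClosed (Γ : Set (E × E))) {A : Set E}
    (hA : Dense A) (hAΓ : ∀ f ∈ A, ∃ v : ℝ≥0 → E, Continuous v ∧ (∀ s, (T s f, v s) ∈ Γ) ∧
      ∀ s, HasRightDeriv (fun s => T s f) s (v s)) {x z : E} (hxz : HasDerivZero T x z) :
    (x, z) ∈ Γ := by
  rw [← SetLike.mem_coe, ← hΓ.closure_eq, Metric.mem_closure_iff]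
  intro ε hε
  obtain ⟨M, a, hM, hTM⟩ := hT.exists_bound
  have hM0 : 0 < M := by linarith
  set K := M * Real.exp |a| with hK
  have hK0 : 0 ≤ K := by positivity
  have hTK : ∀ s : ℝ≥0, s ≤ 1 → ‖T s‖ ≤ K := by
    intro s hs
    refine (hTM s).trans ?_
    have hs' : (s : ℝ) ≤ 1 := hs
    rw [hK]
    gcongr
    calc a * s ≤ |a| * s := by gcongr; exact le_abs_self a
      _ ≤ |a| * 1 := by gcongr
      _ = |a| := mul_one _
  obtain ⟨δ₁, hδ₁, H₁⟩ := Metric.continuousAt_iff.1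
    ((hT.continuous_apply x).continuousAt (x := (0 : ℝ≥0))) (ε / 4) (by positivity)
  obtain ⟨δ, hδ1, hδ2, hδ3, hδ0⟩ := ((eventually_coe_lt hδ₁).and ((eventually_coe_lt one_pos).and
    (((hasDerivZero_iff hT.map_zero).1 hxz (ε / 4) (by positivity)).and
      self_mem_nhdsWithin))).exists
  replace hδ0 : 0 < δ := hδ0
  have hδR : (0 : ℝ) < δ := hδ0
  -- The second radius carries the factor `δ` because `T δ f - f` is later divided by `δ`.
  obtain ⟨f, hf, hxf⟩ := hA.exists_dist_lt x (ε := min (ε / (4 * (K + 1))) (ε / (4 * (K + 1)) * δ))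
    (by positivity)
  rw [dist_eq_norm] at hxf
  have hxf1 := (hxf.trans_le (min_le_left _ _)).le
  have hxf2 := (hxf.trans_le (min_le_right _ _)).le
  obtain ⟨v, hv, hvΓ, hder⟩ := hAΓ f hf
  have hyc : Continuous fun r : ℝ => T r.toNNReal f :=
    (hT.continuous_apply f).comp continuous_real_toNNReal
  have hvc : Continuous fun r : ℝ => v r.toNNReal := hv.comp continuous_real_toNNReal
  have hmem := intervalIntegral_mem_of_isClosed (Γ.restrictScalars ℝ) hΓ hyc hvc
    (fun r => hvΓ _) hδR
  -- So `Γ` contains `δ⁻¹ • (∫ T r f, T δ f - f)`, which is close to `(x, z)` for small `δ` and `f`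
  -- near `x`.
  have hint : ∫ r in (0 : ℝ)..δ, v r.toNNReal = T δ f - f := by
    rw [intervalIntegral.integral_eq_sub_of_hasDeriv_right_of_le hδR.le hyc.continuousOn
      (fun r hr => ?_) (hvc.intervalIntegrable _ _)]
    · simp [hT.map_zero]
    · have := (hder r.toNNReal).hasDerivWithinAt
      rwa [Real.coe_toNNReal r hr.1.le] at this
  rw [hint] at hmem
  refine ⟨_, (Γ.restrictScalars ℝ).smul_mem (δ : ℝ)⁻¹ hmem, ?_⟩
  have hK1 : (K + 1) * (ε / (4 * (K + 1))) = ε / 4 := by field_simp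
  have b1 : ‖(∫ r in (0 : ℝ)..δ, T r.toNNReal f) - (δ : ℝ) • x‖ ≤ ε / 2 * δ := by
    have e : (∫ r in (0 : ℝ)..δ, T r.toNNReal f) - (δ : ℝ) • x =
        ∫ r in (0 : ℝ)..δ, (T r.toNNReal f - x) := by
      rw [intervalIntegral.integral_sub (hyc.intervalIntegrable _ _) (by simp)]
      simp
    rw [e]
    refine (intervalIntegral.norm_integral_le_of_norm_le_const (C := ε / 2) fun r hr => ?_).trans
      (by simp [abs_of_nonneg])
    rw [Set.uIoc_of_le hδR.le] at hr
    have hrδ : r.toNNReal ≤ δ := Real.toNNReal_le_iff_le_coe.2 hr.2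
    have c1 : ‖T r.toNNReal (x - f)‖ ≤ K * (ε / (4 * (K + 1))) :=
      (T _).le_of_opNorm_le_of_le (hTK _ (hrδ.trans hδ2.le)) hxf1
    have c2 : ‖T r.toNNReal x - x‖ < ε / 4 := by
      have := H₁ (x := r.toNNReal) (by
        rw [NNReal.dist_eq, NNReal.coe_zero, sub_zero, abs_of_nonneg (NNReal.coe_nonneg _)]
        exact (show (r.toNNReal : ℝ) ≤ δ from hrδ).trans_lt hδ1)
      rwa [dist_eq_norm, hT.map_zero] at this
    have e2 : T r.toNNReal f - x = (T r.toNNReal x - x) - T r.toNNReal (x - f) := by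
      rw [map_sub]; abel
    rw [e2]
    have c3 : 0 < ε / (4 * (K + 1)) := by positivity
    refine (norm_sub_le _ _).trans ?_
    linarith
  have b2 : ‖(T δ f - f) - (δ : ℝ) • z‖ ≤ ε / 2 * δ := by
    have e : (T δ f - f) - (δ : ℝ) • z = (T δ x - x - (δ : ℝ) • z) - T δ (x - f) + (x - f) := by
      rw [map_sub]; abel
    rw [e]
    have c1 : ‖T δ (x - f)‖ ≤ K * (ε / (4 * (K + 1)) * δ) :=
      (T _).le_of_opNorm_le_of_le (hTK _ hδ2.le) hxf2
    refine (norm_add_le _ _).trans ?_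
    have c2 := norm_sub_le (T δ x - x - (δ : ℝ) • z) (T δ (x - f))
    have c3 : (K + 1) * (ε / (4 * (K + 1)) * δ) = ε / 4 * δ := by rw [← mul_assoc, hK1]
    linarith
  have key : ∀ {u w : E}, ‖u - (δ : ℝ) • w‖ ≤ ε / 2 * δ → dist w ((δ : ℝ)⁻¹ • u) < ε := by
    intro u w h
    have e : (δ : ℝ)⁻¹ • u - w = (δ : ℝ)⁻¹ • (u - (δ : ℝ) • w) := by
      rw [smul_sub, inv_smul_smul₀ hδR.ne']
    rw [dist_comm, dist_eq_norm, e, norm_smul, norm_inv, Real.norm_of_nonneg hδR.le]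
    calc _ ≤ (δ : ℝ)⁻¹ * (ε / 2 * δ) := by gcongr
      _ = ε / 2 := by field_simp
      _ < ε := by linarith
  rw [Prod.dist_eq]
  exact max_lt (key b1) (key b2)

end

/-! ### The limit semigroup and Chernoff's formula. -/

section

variable {𝕜 : Type*} [RCLike 𝕜] {E : Type*} [NormedAddCommGroup E] [NormedSpace 𝕜 E]
variable [NormedSpace ℝ E] [IsScalarTower ℝ 𝕜 E] {F : ℝ≥0 → E →L[𝕜] E}

/-- The strong limit of `F(h)^⌊s/h⌋` along a sequence `h → 0` is a `C₀`-semigroup. -/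
theorem isC0Semigroup_of_tendsto {G : Set (E × E)} (h0 : F 0 = 1) {M a : ℝ} (hM : 1 ≤ M)
    (hexp : ∀ h : ℝ≥0, 0 < h → ∀ m : ℕ, ‖F h ^ m‖ ≤ M * Real.exp (a * (m * h)))
    (hG : ∀ p ∈ G, HasDerivZero F p.1 p.2) (hd : Dense (Prod.fst '' G)) {h : ℕ → ℝ≥0}
    (hh : Tendsto h atTop (𝓝[>] 0)) {T : ℝ≥0 → E →L[𝕜] E}
    (hT : ∀ s x, Tendsto (fun n => (F (h n) ^ ⌊s / h n⌋₊) x) atTop (𝓝 (T s x))) :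
    IsC0Semigroup T := by
  have hF := isLocallyStable_of_exp hM hexp
  have hpos : ∀ᶠ n in atTop, 0 < h n := hh.eventually self_mem_nhdsWithin
  have hbound : ∀ s : ℝ≥0, ‖T s‖ ≤ M * Real.exp (a * s) := by
    intro s
    refine (T s).opNorm_le_bound (by positivity) fun x => ?_
    have hlim : Tendsto (fun n => (⌊s / h n⌋₊ : ℝ) * h n) atTop (𝓝 s) := by
      have hh0 : Tendsto (fun n => (h n : ℝ)) atTop (𝓝 0) :=
        (NNReal.continuous_coe.tendsto 0).comp (hh.mono_right nhdsWithin_le_nhds)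
      refine tendsto_of_tendsto_of_tendsto_of_le_of_le'
        (by simpa using hh0.const_sub (s : ℝ)) tendsto_const_nhds ?_ ?_
      · filter_upwards [hpos] with n hn
        linarith [lt_floor_div_mul_add s hn]
      · filter_upwards [hpos] with n hn using floor_div_mul_le s hn
    have hlim2 : Tendsto (fun n => M * Real.exp (a * ((⌊s / h n⌋₊ : ℝ) * h n)) * ‖x‖) atTop
        (𝓝 (M * Real.exp (a * s) * ‖x‖)) :=
      (((Real.continuous_exp.tendsto _).comp (hlim.const_mul a)).const_mul M).mul_const ‖x‖
    refine le_of_tendsto_of_tendsto (hT s x).norm hlim2 ?_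
    filter_upwards [hpos] with n hn
    exact (F (h n) ^ _).le_of_opNorm_le (hexp _ hn _) x
  -- `M + 1`, since the constant of a semigroup must exceed 1 strictly.
  refine ⟨?_, fun l m => ?_, fun x => ?_, M + 1, a, by linarith, fun s => (hbound s).trans ?_⟩
  · ext x
    refine tendsto_nhds_unique (hT 0 x) ?_
    simp
  · ext x
    have hsum : Tendsto (fun n => (F (h n) ^ ⌊l / h n⌋₊) ((F (h n) ^ ⌊m / h n⌋₊) x)) atTop
        (𝓝 (T l (T m x))) := by
      obtain ⟨K, hK1, hK⟩ := hF l
      have a1 : Tendsto (fun n => (F (h n) ^ ⌊l / h n⌋₊) ((F (h n) ^ ⌊m / h n⌋₊) x - T m x)) atTop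
          (𝓝 0) := by
        have a2 := tendsto_zero_iff_norm_tendsto_zero.1 (tendsto_sub_nhds_zero_iff.2 (hT m x))
        refine squeeze_zero_norm' ?_ (by have := a2.const_mul K; rwa [mul_zero] at this)
        filter_upwards [hpos] with n hn
        exact (F (h n) ^ _).le_of_opNorm_le (hK _ hn _ (floor_div_mul_le l hn)) _
      have a3 := a1.add (hT l (T m x))
      rw [zero_add] at a3
      refine a3.congr fun n => ?_
      rw [map_sub, sub_add_cancel]
    -- The two step counts differ by a bounded number, hence the times by `O(h n)`, and
    -- equicontinuity applies.
    have hdiff : Tendsto (fun n => (F (h n) ^ ⌊(l + m) / h n⌋₊) x -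
        (F (h n) ^ ⌊l / h n⌋₊) ((F (h n) ^ ⌊m / h n⌋₊) x)) atTop (𝓝 0) := by
      rw [Metric.tendsto_nhds]
      intro ε hε
      obtain ⟨δ, hδ, H⟩ := eventually_norm_pow_sub_pow_le h0 hF hG hd x (l + m) (half_pos hε)
      filter_upwards [hpos, hh.eventually H, hh.eventually (eventually_coe_lt (half_pos hδ))]
        with n hn h1 h2
      have b1 := floor_div_mul_le (l + m) hn
      have b2 := floor_div_mul_le l hn
      have b3 := floor_div_mul_le m hn
      have c1 := lt_floor_div_mul_add (l + m) hn
      have c2 := lt_floor_div_mul_add l hn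
      have c3 := lt_floor_div_mul_add m hn
      rw [NNReal.coe_add] at b1 c1
      have h3 := h1 ⌊(l + m) / h n⌋₊ (⌊l / h n⌋₊ + ⌊m / h n⌋₊) b1
        (by push_cast; linarith) (by
          push_cast
          rw [abs_le]
          constructor <;> linarith)
      rw [dist_zero_right, ← mul_apply_eq_comp, ← pow_add]
      linarith
    have h4 := (hT (l + m) x).sub hsum
    exact sub_eq_zero.1 (tendsto_nhds_unique h4 hdiff)
  · exact continuous_of_tendstoWeakly_pow_floor h0 hF hG hd hh
      (fun s => TendstoWeakly.of_tendsto (hT s x))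
  · gcongr
    linarith

/-- If the Cauchy problem for the closure of `G` can be solved for a dense set of initial values,
then this closure is the graph of the generator of a `C₀`-semigroup. -/
theorem exists_isC0Semigroup [CompleteSpace E] {G : Submodule 𝕜 (E × E)} (h0 : F 0 = 1) {M a : ℝ}
    (hM : 1 ≤ M) (hexp : ∀ h : ℝ≥0, 0 < h → ∀ m : ℕ, ‖F h ^ m‖ ≤ M * Real.exp (a * (m * h)))
    (hG : ∀ p ∈ G, HasDerivZero F p.1 p.2) (hd : Dense (Prod.fst '' (G : Set (E × E))))
    {h : ℕ → ℝ≥0} (hh : Tendsto h atTop (𝓝[>] 0)) {A : Set E} (hA : Dense A)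
    (hsol : ∀ f ∈ A, ∃ y v : ℝ≥0 → E, y 0 = f ∧ Continuous y ∧ Continuous v ∧
      (∀ s, (y s, v s) ∈ closure (G : Set (E × E))) ∧ ∀ s, HasRightDeriv y s (v s)) :
    ∃ T : ℝ≥0 → E →L[𝕜] E, IsC0Semigroup T ∧
      ∀ x z, HasDerivZero T x z ↔ (x, z) ∈ closure (G : Set (E × E)) := by
  have hF := isLocallyStable_of_exp hM hexp
  have hlim : ∀ s x, ∃ l, Tendsto (fun n => (F (h n) ^ ⌊s / h n⌋₊) x) atTop (𝓝 l) := by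
    intro s x
    obtain ⟨K, -, hK⟩ := hF s
    refine exists_tendsto_of_dense (K := K) ?_ hA (fun f hf => ?_) x
    · filter_upwards [hh.eventually self_mem_nhdsWithin] with n (hn : 0 < h n)
      exact hK _ hn _ (floor_div_mul_le s hn)
    · obtain ⟨y, v, rfl, hy, -, hyv, hder⟩ := hsol f hf
      exact ⟨_, tendsto_pow_floor_of_hasRightDeriv h0 hF hG hd hy hyv hder hh s⟩
  choose L hL using hlim
  let T : ℝ≥0 → E →L[𝕜] E := fun s => continuousLinearMapOfTendsto
    (fun n => F (h n) ^ ⌊s / h n⌋₊) (f := L s) (tendsto_pi_nhds.2 (hL s))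
  have hT : ∀ s x, Tendsto (fun n => (F (h n) ^ ⌊s / h n⌋₊) x) atTop (𝓝 (T s x)) := hL
  have hTC := isC0Semigroup_of_tendsto h0 hM hexp hG hd hh hT
  refine ⟨T, hTC, fun x z => ⟨fun hxz => ?_, fun hxz => ?_⟩⟩
  · refine hTC.mem_of_hasDerivZero G.topologicalClosure G.isClosed_topologicalClosure hA
      (fun f hf => ?_) hxz
    obtain ⟨y, v, rfl, hy, hv, hyv, hder⟩ := hsol f hf
    -- Every solution is a limit of the same powers, hence is the orbit of its initial value under
    -- `T`.
    have hyT : (fun s => T s (y 0)) = y := funext fun s => tendsto_nhds_unique (hT s (y 0))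
      (tendsto_pow_floor_of_hasRightDeriv h0 hF hG hd hy hyv hder hh s)
    refine ⟨v, hv, fun s => ?_, fun s => by rw [hyT]; exact hder s⟩
    rw [congrFun hyT s]
    exact hyv s
  · have hr := hasRightDeriv_of_tendstoWeakly h0 hF hG hd hh hxz
      (fun s => TendstoWeakly.of_tendsto (hT s x)) (fun s => TendstoWeakly.of_tendsto (hT s z)) 0
    rw [hasDerivZero_iff hTC.map_zero]
    simpa [HasRightDeriv, hTC.map_zero] using hr

/-- Chernoff's product formula along time steps `h n → 0`. -/
theorem tendsto_pow_floor_of_isC0Semigroup {G : Set (E × E)} (h0 : F 0 = 1)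
    (hF : IsLocallyStable F) (hG : ∀ p ∈ G, HasDerivZero F p.1 p.2) (hd : Dense (Prod.fst '' G))
    {T : ℝ≥0 → E →L[𝕜] E} (hT : IsC0Semigroup T)
    (hTG : ∀ x z, HasDerivZero T x z ↔ (x, z) ∈ closure G) {h : ℕ → ℝ≥0}
    (hh : Tendsto h atTop (𝓝[>] 0)) (s : ℝ≥0) (f : E) :
    Tendsto (fun n => (F (h n) ^ ⌊s / h n⌋₊) f) atTop (𝓝 (T s f)) := by
  obtain ⟨K, -, hK⟩ := hF s
  refine tendsto_apply_of_dense (K := K) ?_ hd ?_ f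
  · filter_upwards [hh.eventually self_mem_nhdsWithin] with n (hn : 0 < h n)
    exact hK _ hn _ (floor_div_mul_le s hn)
  · rintro _ ⟨p, hp, rfl⟩
    have hp' : HasDerivZero T p.1 p.2 := (hTG _ _).2 (subset_closure hp)
    have := tendsto_pow_floor_of_hasRightDeriv h0 hF hG hd (hT.continuous_apply p.1)
      (fun r => (hTG _ _).1 (hT.hasDerivZero_apply hp' r)) (hT.hasRightDeriv hp') hh s
    simpa [hT.map_zero] using this

end

/-! ### Closability, adjoints and the equivalence for a general family `F`. -/

section

variable {𝕜 : Type*} [RCLike 𝕜] {E : Type*} [NormedAddCommGroup E] [NormedSpace 𝕜 E]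

theorem mem_graph_derivZero {S : ℝ≥0 → E →L[𝕜] E} {x z : E} :
    (x, z) ∈ (derivZero S).graph ↔ HasDerivZero S x z := by
  rw [LinearPMap.mem_graph_iff]
  constructor
  · rintro ⟨ψ, rfl, rfl⟩
    exact hasDerivZero_derivZero S ψ
  · intro h
    exact ⟨⟨x, z, h⟩, rfl, (hasDerivZero_derivZero S ⟨x, z, h⟩).unique h⟩

theorem isGeneratorOf_closure_iff {L : E →ₗ.[𝕜] E} (hL : L.IsClosable)
    {T : ℝ≥0 → E →L[𝕜] E} : IsGeneratorOf L.closure T ↔ IsC0Semigroup T ∧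
      ∀ x z, HasDerivZero T x z ↔ (x, z) ∈ closure (L.graph : Set (E × E)) := by
  have hgr : (L.closure.graph : Set (E × E)) = closure L.graph := by
    rw [← hL.graph_closure_eq_closure_graph, Submodule.topologicalClosure_coe]
  refine and_congr_right fun _ => ⟨fun h x z => ?_, fun h => LinearPMap.eq_of_eq_graph ?_⟩
  · rw [← mem_graph_derivZero, ← h, ← hgr, SetLike.mem_coe]
  · ext ⟨x, z⟩
    rw [mem_graph_derivZero, h, ← hgr, SetLike.mem_coe]

/-- If `(0, z)` is in the closure of the graph, then `φ z = ψ 0 = 0` for all `φ ∈ B`, so `z = 0`. No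
approximants are needed. -/
theorem isClosable_of_hasDerivZero_adjointFun {F : ℝ≥0 → E →L[𝕜] E} {L : E →ₗ.[𝕜] E}
    (hG : ∀ p ∈ L.graph, HasDerivZero F p.1 p.2) {B : Set (StrongDual 𝕜 E)}
    (hB : ∀ φ ∈ B, ∃ ψ, HasDerivZero (adjointFun F) φ ψ)
    (hsep : ∀ x : E, (∀ φ ∈ B, φ x = 0) → x = 0) : L.IsClosable := by
  refine ⟨L.graph.topologicalClosure.toLinearPMap,
    (Submodule.toLinearPMap_graph_eq _ fun p hp hp0 => hsep _ fun φ hφ => ?_).symm⟩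
  obtain ⟨ψ, hψ⟩ := hB φ hφ
  rw [apply_snd_eq_apply_fst_of_mem_closure hG hψ hp, hp0, map_zero]

theorem adjointFun_zero {S : ℝ≥0 → E →L[𝕜] E} (hS : S 0 = 1) : adjointFun S 0 = 1 := by
  ext φ x
  simp [adjointFun, hS]

theorem adjointFun_mul (S R : ℝ≥0 → E →L[𝕜] E) :
    adjointFun (fun s => S s * R s) = fun s => adjointFun R s * adjointFun S s := by
  ext s φ x
  simp [adjointFun]

theorem norm_adjointFun_le (S : ℝ≥0 → E →L[𝕜] E) (s : ℝ≥0) : ‖adjointFun S s‖ ≤ ‖S s‖ := by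
  refine ContinuousLinearMap.opNorm_le_bound _ (norm_nonneg _) fun φ => ?_
  rw [mul_comm]
  exact φ.opNorm_comp_le (S s)

/-- Vanishing at `x` is a weak-* closed condition on functionals. -/
theorem eq_zero_of_dense_toWeakDual {B : Set (StrongDual 𝕜 E)}
    (hB : Dense (StrongDual.toWeakDual '' B)) {x : E} (hx : ∀ φ ∈ B, φ x = 0) : x = 0 := by
  refine (SeparatingDual.eq_zero_iff_forall_dual_eq_zero (R := 𝕜) x).2 fun φ => ?_
  have hclosed : IsClosed {w : WeakDual 𝕜 E | w x = 0} :=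
    isClosed_eq (WeakDual.eval_continuous x) continuous_const
  have hsub : StrongDual.toWeakDual '' B ⊆ {w : WeakDual 𝕜 E | w x = 0} := by
    rintro _ ⟨φ, hφ, rfl⟩
    exact hx φ hφ
  exact closure_minimal hsub hclosed (hB (StrongDual.toWeakDual φ))

theorem tendsto_div_natCast_nhdsGT {t : ℝ≥0} (ht : 0 < t) :
    Tendsto (fun n : ℕ => t / n) atTop (𝓝[>] 0) := by
  refine tendsto_nhdsWithin_iff.2 ⟨tendsto_const_div_atTop_nhds_zero_nat t, ?_⟩
  filter_upwards [eventually_gt_atTop 0] with n hn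
  exact div_pos ht (by exact_mod_cast hn)

theorem hasWeaklyConvergentSubsubsequences_of_tendsto {u : ℕ → E} {y : E}
    (h : Tendsto u atTop (𝓝 y)) : HasWeaklyConvergentSubsubsequences 𝕜 u := fun _ hi =>
  ⟨id, strictMono_id, y, tendsto_toWeakSpace_iff.2
    (TendstoWeakly.of_tendsto (h.comp hi.tendsto_atTop))⟩

/-- Generation theorem and product formula for a stable family `F` that is consistent with a
densely defined operator `L`, and whose adjoint is differentiable at zero on a separating set. -/
theorem closure_isGeneratorOf_iff_hasApproximants [CompleteSpace E] [NormedSpace ℝ E]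
    [IsScalarTower ℝ 𝕜 E] {F : ℝ≥0 → E →L[𝕜] E} (h0 : F 0 = 1) {M a : ℝ} (hM : 1 ≤ M)
    (hexp : ∀ h : ℝ≥0, 0 < h → ∀ m : ℕ, ‖F h ^ m‖ ≤ M * Real.exp (a * (m * h)))
    {L : E →ₗ.[𝕜] E} (hL : Dense (L.domain : Set E))
    (hG : ∀ p ∈ L.graph, HasDerivZero F p.1 p.2) {B : Set (StrongDual 𝕜 E)}
    (hB : ∀ φ ∈ B, ∃ ψ, HasDerivZero (adjointFun F) φ ψ)
    (hsep : ∀ x : E, (∀ φ ∈ B, φ x = 0) → x = 0) {t : ℝ≥0} (ht : 0 < t) :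
    ((L.IsClosable ∧ ∃ T : ℝ≥0 → E →L[𝕜] E, IsGeneratorOf L.closure T) ↔
      HasApproximants L F t) ∧
    ∀ T : ℝ≥0 → E →L[𝕜] E, IsGeneratorOf L.closure T → ∀ (s : ℝ≥0) (f : E),
      Tendsto (fun n : ℕ => (F (s / n) ^ n) f) atTop (𝓝 (T s f)) := by
  have hF := isLocallyStable_of_exp hM hexp
  have hd : Dense (Prod.fst '' (L.graph : Set (E × E))) := hL.mono fun x hx =>
    ⟨_, L.mem_graph ⟨x, hx⟩, rfl⟩
  have hcl := isClosable_of_hasDerivZero_adjointFun hG hB hsep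
  have hh := tendsto_div_natCast_nhdsGT ht
  refine ⟨⟨?_, ?_⟩, ?_⟩
  · rintro ⟨-, T, hT⟩
    obtain ⟨hTC, hTG⟩ := (isGeneratorOf_closure_iff hcl).1 hT
    refine ⟨L.domain, le_rfl, hL, fun f hf s => ?_⟩
    -- `⌊n * s⌋₊` steps of length `t / n` approximate the time `t * s`, not `s`.
    have hfz := hTC.hasDerivZero_apply ((hTG _ _).2 (subset_closure (L.mem_graph ⟨f, hf⟩))) (t * s)
    obtain ⟨p, hpG, hp⟩ := mem_closure_iff_seq_limit.1 ((hTG _ _).1 hfz)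
    choose g hg1 hg2 using fun n => (LinearPMap.mem_graph_iff _).1 (hpG n)
    refine ⟨g, ?_, ?_, ?_⟩
    · have h1 := tendsto_pow_floor_of_isC0Semigroup h0 hF hG hd hTC hTG hh (t * s) f
      have h2 := (h1.sub ((continuous_fst.tendsto _).comp hp)).norm
      simp only [sub_self, norm_zero] at h2
      refine h2.congr fun n => ?_
      have e : t * s / (t / n) = n * s := by
        rw [div_div_eq_mul_div]
        field_simp
      rw [e, hg1]
      rfl
    · refine hasWeaklyConvergentSubsubsequences_of_tendsto
        (((continuous_fst.tendsto _).comp hp).congr fun n => (hg1 n).symm)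
    · refine hasWeaklyConvergentSubsubsequences_of_tendsto
        (((continuous_snd.tendsto _).comp hp).congr fun n => (hg2 n).symm)
  · rintro ⟨A, hAL, hA, happ⟩
    refine ⟨hcl, ?_⟩
    obtain ⟨T, hT⟩ := exists_isC0Semigroup h0 hM hexp hG hd hh hA fun f hf =>
      exists_hasRightDeriv h0 hF hG hB hsep hh hA
        (fun f hf => ⟨_, L.mem_graph ⟨f, hAL hf⟩⟩) (fun f hf s => by
          obtain ⟨g, h1, h2, h3⟩ := happ f hf (s / t)
          refine ⟨fun n => (g n, L (g n)), fun n => L.mem_graph _, ?_, h2, h3⟩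
          refine h1.congr fun n => ?_
          have e : s / (t / n) = n * (s / t) := by
            rw [div_div_eq_mul_div]
            ring
          rw [e]) hf
    exact ⟨T, (isGeneratorOf_closure_iff hcl).2 hT⟩
  · intro T hT s f
    obtain ⟨hTC, hTG⟩ := (isGeneratorOf_closure_iff hcl).1 hT
    rcases eq_or_ne s 0 with rfl | hs
    · simp [h0, hTC.map_zero]
    · have hs' : 0 < s := pos_iff_ne_zero.2 hs
      refine (tendsto_pow_floor_of_isC0Semigroup h0 hF hG hd hTC hTG
        (tendsto_div_natCast_nhdsGT hs') s f).congr fun n => ?_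
      have e : s / (s / n) = n := by
        rw [div_div_eq_mul_div]
        field_simp
      rw [e, Nat.floor_natCast]

end

end TrotterChernoff

end

/-! ### Application to the Trotter product. -/

theorem mainTheorem8 {𝕜 : Type*} [RCLike 𝕜] {X : Type*} [NormedAddCommGroup X] [NormedSpace 𝕜 X]
    [CompleteSpace X] (t : ℝ≥0) (ht : 0 < t)
    (C D : X →ₗ.[𝕜] X) (expC expD : ℝ≥0 → X →L[𝕜] X)
    (hC : TrotterChernoff.IsGeneratorOf C expC) (hD : TrotterChernoff.IsGeneratorOf D expD)
    (B : Set (StrongDual 𝕜 X))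
    (hBC : B ⊆ (TrotterChernoff.derivZero (TrotterChernoff.adjointFun expC)).domain)
    (hBD : B ⊆ (TrotterChernoff.derivZero (TrotterChernoff.adjointFun expD)).domain)
    (h_dom : Dense ((C.domain ⊓ D.domain : Submodule 𝕜 X) : Set X))
    (h_weakStar : Dense (StrongDual.toWeakDual '' B))
    (h_stab : ∃ a M : ℝ, 1 ≤ M ∧ ∀ n m : ℕ, 0 < n → 0 < m → ∀ s : ℝ≥0, 0 < s →
      ‖(expC (s / n) * expD (s / n)) ^ m‖ ≤ M * Real.exp (a * s * (m / n)))
    (h_cont : ∀ (φ : StrongDual 𝕜 X) (hφ : φ ∈ B), ContinuousAt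
      (fun s : ℝ≥0 => TrotterChernoff.adjointFun expD s
        (TrotterChernoff.derivZero (TrotterChernoff.adjointFun expC) ⟨φ, hBC hφ⟩)) 0) :
    (((C + D).IsClosable ∧
        ∃ T : ℝ≥0 → X →L[𝕜] X, TrotterChernoff.IsGeneratorOf (C + D).closure T) ↔
      TrotterChernoff.HasApproximants (C + D) (fun s => expC s * expD s) t) ∧
    (TrotterChernoff.HasApproximants (C + D) (fun s => expC s * expD s) t →
      ∀ T : ℝ≥0 → X →L[𝕜] X, TrotterChernoff.IsGeneratorOf (C + D).closure T →
        ∀ (s : ℝ≥0) (f : X),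
          Tendsto (fun n : ℕ => ((expC (s / n) * expD (s / n)) ^ n) f) atTop (𝓝 (T s f))) := by
  let _ : NormedSpace ℝ X := NormedSpace.restrictScalars ℝ 𝕜 X
  have _ : IsScalarTower ℝ 𝕜 X :=
    ⟨fun r c x => by rw [RCLike.real_smul_eq_coe_mul, mul_smul]; rfl⟩
  obtain ⟨hC, rfl⟩ := hC
  obtain ⟨hD, rfl⟩ := hD
  obtain ⟨a, M, hM, hst⟩ := h_stab
  have h0 : expC 0 * expD 0 = 1 := by rw [hC.map_zero, hD.map_zero, one_mul]
  have hexp : ∀ h : ℝ≥0, 0 < h → ∀ m : ℕ,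
      ‖(expC h * expD h) ^ m‖ ≤ M * Real.exp (a * (m * h)) := by
    intro h hh m
    rcases Nat.eq_zero_or_pos m with rfl | hm
    · have : ‖(1 : X →L[𝕜] X)‖ ≤ 1 := ContinuousLinearMap.norm_id_le
      simpa using this.trans hM
    -- Since `s` is arbitrary, the case `n = 1` already covers every step size.
    · have := hst 1 m one_pos hm h hh
      simp only [Nat.cast_one, div_one] at this
      rwa [mul_comm (m : ℝ), ← mul_assoc]
  have hG : ∀ p ∈ (TrotterChernoff.derivZero expC + TrotterChernoff.derivZero expD).graph,
      TrotterChernoff.HasDerivZero (fun s => expC s * expD s) p.1 p.2 := by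
    intro p hp
    obtain ⟨x, hx1, hx2⟩ := (LinearPMap.mem_graph_iff _).1 hp
    obtain ⟨K, hK⟩ := hC.eventually_norm_le
    have hxC := TrotterChernoff.hasDerivZero_derivZero expC ⟨x, x.2.1⟩
    have hxD := TrotterChernoff.hasDerivZero_derivZero expD ⟨x, x.2.2⟩
    have hc := (hC.continuous_apply
      (TrotterChernoff.derivZero expD ⟨x, x.2.2⟩)).tendsto 0
    rw [hC.map_zero] at hc
    have := hxD.mul hC.map_zero hD.map_zero hK hxC (hc.mono_left nhdsWithin_le_nhds)
    rw [← hx1, ← hx2]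
    convert this using 1
    exact add_comm _ _
  have hB : ∀ φ ∈ B, ∃ ψ, TrotterChernoff.HasDerivZero
      (TrotterChernoff.adjointFun fun s => expC s * expD s) φ ψ := by
    intro φ hφ
    obtain ⟨K, hK⟩ := hD.eventually_norm_le
    have hc : Tendsto _ _ _ := h_cont φ hφ
    beta_reduce at hc
    rw [TrotterChernoff.adjointFun_zero hD.map_zero] at hc
    -- Adjoints reverse the product, so the outer factor is the adjoint of `expD`; the product rule
    -- needs its continuity exactly at the derivative of the adjoint of `expC`, which is (iv).
    rw [TrotterChernoff.adjointFun_mul]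
    exact ⟨_, (TrotterChernoff.hasDerivZero_derivZero _ ⟨φ, hBC hφ⟩).mul
      (TrotterChernoff.adjointFun_zero hD.map_zero) (TrotterChernoff.adjointFun_zero hC.map_zero)
      (hK.mono fun h hh => (TrotterChernoff.norm_adjointFun_le expD h).trans hh)
      (TrotterChernoff.hasDerivZero_derivZero _ ⟨φ, hBD hφ⟩)
      (hc.mono_left nhdsWithin_le_nhds)⟩
  obtain ⟨h1, h2⟩ := TrotterChernoff.closure_isGeneratorOf_iff_hasApproximants h0 hM hexp h_dom hG
    hB (fun x => TrotterChernoff.eq_zero_of_dense_toWeakDual h_weakStar) ht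
  exact ⟨h1, fun _ => h2⟩
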